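/- Let $K$ be a field, let $\Delta$ be a finite simplicial complex (with $\varnothing\in\Delta$) of dimension $d-1$, and let $t$ be an integer. For a face $\sigma\in\Delta$ put $\mathrm{lk}_\Delta(\sigma)=\{\tau\in\Delta : \tau\cup\sigma\in\Delta,\ \tau\cap\sigma=\varnothing\}$. A complex is called Cohen--Macaulay over $K$ if its Stanley--Reisner ring over $K$ is a Cohen--Macaulay ring, and pure if all its facets have the same dimension. The complex $\Delta$ is called $\mathrm{CM}_t$ over $K$ if $\Delta$ is pure and $\mathrm{lk}_\Delta(\sigma)$ is Cohen--Macaulay over $K$ for every $\sigma\in\Delta$ with $\#\sigma\ge t$. Then the following are equivalent: (i) $\Delta$ is $\mathrm{CM}_t$ over $K$; (ii) $\Delta$ is pure and $\tilde H_i(\mathrm{lk}_\Delta(\sigma);K)=0$ for all $\sigma\in\Delta$ with $\#\sigma\ge t$ and all integers $i<d-\#\sigma-1$, where $\tilde H_i$ denotes reduced simplicial homology. -/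

import Mathlib

/-- A Noetherian local ring is Cohen–Macaulay if its maximal ideal contains a regular sequence
whose length is the Krull dimension (i.e. depth equals dimension). -/
def IsCohenMacaulayLocal (R : Type*) [CommRing R] [IsLocalRing R] : Prop :=
  IsNoetherianRing R ∧ ∃ rs : List R, (∀ r ∈ rs, r ∈ IsLocalRing.maximalIdeal R) ∧
    RingTheory.Sequence.IsRegular R rs ∧ (rs.length : WithBot ℕ∞) = ringKrullDim R

/-- A commutative ring is Cohen–Macaulay if it is Noetherian and its localization at every
maximal ideal is a Cohen–Macaulay local ring. -/
def IsCohenMacaulay (R : Type*) [CommRing R] : Prop :=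
  IsNoetherianRing R ∧ ∀ (m : Ideal R) [m.IsMaximal],
    IsCohenMacaulayLocal (Localization.AtPrime m)

/-- A finite (abstract) simplicial complex with vertices in `V`. The empty set is a face (whereas
Mathlib's `PreAbstractSimplicialComplex` lists only the nonempty faces); not every element of `V`
has to be a vertex, so that links of faces are again complexes over `V`. -/
structure SimplComplex (V : Type*) where
  /-- the faces, including the empty face -/
  faces : Finset (Finset V)
  empty_mem : ∅ ∈ faces
  down_closed : ∀ σ ∈ faces, ∀ τ ⊆ σ, τ ∈ faces

/-- The quotient module `p / (p ∩ q)`, which is `p / q` when `q ≤ p`. -/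
abbrev Subquotient {K M : Type*} [Field K] [AddCommGroup M] [Module K M]
    (p q : Submodule K M) : Type _ :=
  p ⧸ q.submoduleOf p

namespace SimplComplex

section Combinatorics

variable {V : Type*}

instance : Membership (Finset V) (SimplComplex V) := ⟨fun Δ σ => σ ∈ Δ.faces⟩

/-- The dimension: one less than the largest cardinality of a face. -/
def dim (Δ : SimplComplex V) : ℤ := (Δ.faces.sup Finset.card : ℕ) - 1

/-- A facet is a face that is maximal under inclusion. -/
def IsFacet (Δ : SimplComplex V) (σ : Finset V) : Prop :=
  σ ∈ Δ ∧ ∀ τ ∈ Δ, σ ⊆ τ → τ = σ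

/-- A complex is pure if all its facets have the same cardinality. -/
def IsPure (Δ : SimplComplex V) : Prop :=
  ∀ σ τ : Finset V, Δ.IsFacet σ → Δ.IsFacet τ → σ.card = τ.card

/-- The link of a face `σ`: the faces `τ` with `τ ∪ σ ∈ Δ` and `τ ∩ σ = ∅`. -/
def link [DecidableEq V] (Δ : SimplComplex V) (σ : Finset V) (hσ : σ ∈ Δ) : SimplComplex V where
  faces := Δ.faces.filter fun τ => τ ∪ σ ∈ Δ.faces ∧ τ ∩ σ = ∅
  empty_mem := by
    have h : σ ∈ Δ.faces := hσ
    simpa using And.intro Δ.empty_mem h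
  down_closed := by
    intro ρ hρ τ hτ
    rw [Finset.mem_filter] at hρ ⊢
    refine ⟨Δ.down_closed _ hρ.1 _ hτ, Δ.down_closed _ hρ.2.1 _ (Finset.union_subset_union_left hτ),
      ?_⟩
    exact Finset.subset_empty.1 (hρ.2.2 ▸ Finset.inter_subset_inter_right hτ)

end Combinatorics

section Algebra

variable {V : Type*} (K : Type*) [Field K]

/-- The Stanley–Reisner ideal, generated by the squarefree monomials `∏ v ∈ F, X v` of the
non-faces `F`. -/
noncomputable def stanleyReisnerIdeal (Δ : SimplComplex V) : Ideal (MvPolynomial V K) :=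
  Ideal.span {p | ∃ F : Finset V, F ∉ Δ ∧ p = ∏ v ∈ F, MvPolynomial.X v}

/-- The Stanley–Reisner ring `K[Δ]`. -/
abbrev StanleyReisnerRing (Δ : SimplComplex V) : Type _ :=
  MvPolynomial V K ⧸ Δ.stanleyReisnerIdeal K

/-- `Δ` is Cohen–Macaulay over `K` if its Stanley–Reisner ring `K[Δ]` is Cohen–Macaulay. -/
def IsCM (Δ : SimplComplex V) : Prop := IsCohenMacaulay (Δ.StanleyReisnerRing K)

/-- `Δ` is `CM_t` over `K` if it is pure and the link of every face with at least `t` vertices is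
Cohen–Macaulay over `K`. For `t ≤ 0` this is the same as `CM_0`. -/
def IsCMt [DecidableEq V] (Δ : SimplComplex V) (t : ℤ) : Prop :=
  Δ.IsPure ∧ ∀ (σ : Finset V) (hσ : σ ∈ Δ), t ≤ (σ.card : ℤ) → (Δ.link σ hσ).IsCM K

end Algebra

section Homology

variable {V : Type*} [LinearOrder V] (K : Type*) [Field K]

/-- The augmented simplicial boundary map on formal combinations of finite sets of vertices, with
respect to the given order of the vertices: `∂ {v₀ < ⋯ < vₙ} = ∑ⱼ (-1)ʲ {v₀, …, vₙ} \ {vⱼ}`.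
In particular `∂ {v} = ∅` and `∂ ∅ = 0`. -/
noncomputable def boundary : (Finset V →₀ K) →ₗ[K] (Finset V →₀ K) :=
  Finsupp.linearCombination K fun F : Finset V =>
    ∑ v ∈ F, Finsupp.single (F.erase v) ((-1 : K) ^ (F.filter (· < v)).card)

/-- The space of `i`-chains of `Δ`, spanned by the faces with `i + 1` vertices. -/
def chains (Δ : SimplComplex V) (i : ℤ) : Submodule K (Finset V →₀ K) :=
  Finsupp.supported K K {F : Finset V | F ∈ Δ ∧ (F.card : ℤ) = i + 1}

/-- The `i`-cycles: `i`-chains with zero boundary. -/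
noncomputable def cycles (Δ : SimplComplex V) (i : ℤ) : Submodule K (Finset V →₀ K) :=
  Δ.chains K i ⊓ LinearMap.ker (boundary K)

/-- The `i`-boundaries: boundaries of `(i + 1)`-chains. -/
noncomputable def boundaries (Δ : SimplComplex V) (i : ℤ) : Submodule K (Finset V →₀ K) :=
  (Δ.chains K (i + 1)).map (boundary K)

theorem boundary_single (F : Finset V) (c : K) :
    boundary K (Finsupp.single F c) = c •
      ∑ v ∈ F, Finsupp.single (F.erase v) ((-1 : K) ^ (F.filter (· < v)).card) := by
  simp [boundary]

theorem boundary_boundary (x : Finset V →₀ K) : boundary K (boundary K x) = 0 := by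
  induction x using Finsupp.induction_linear with
  | zero => simp
  | add f g hf hg => simp [hf, hg]
  | single F c =>
    rw [boundary_single, map_smul, map_sum]
    simp only [boundary_single]
    have key : ∑ v ∈ F, ((-1 : K) ^ (F.filter (· < v)).card) • ∑ w ∈ F.erase v,
        Finsupp.single ((F.erase v).erase w)
          ((-1 : K) ^ ((F.erase v).filter (· < w)).card) = 0 := by
      simp only [Finset.smul_sum, Finsupp.smul_single, smul_eq_mul]
      rw [Finset.sum_sigma']
      refine Finset.sum_involution (fun p _ => ⟨p.2, p.1⟩) ?_ ?_ ?_ ?_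
      · rintro ⟨v, w⟩ h
        simp only [Finset.mem_sigma, Finset.mem_erase] at h
        obtain ⟨hv, hwv, hw⟩ := h
        have aux : ∀ a b : V, a ∈ F → b ∈ F → a < b →
            Finsupp.single ((F.erase a).erase b) ((-1 : K) ^ (F.filter (· < a)).card *
              (-1) ^ ((F.erase a).filter (· < b)).card) +
            Finsupp.single ((F.erase b).erase a) ((-1 : K) ^ (F.filter (· < b)).card *
              (-1) ^ ((F.erase b).filter (· < a)).card) = 0 := by
          intro a b ha hb hab
          have h1 : ((F.erase a).filter (· < b)).card + 1 = (F.filter (· < b)).card := by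
            rw [Finset.filter_erase]
            exact Finset.card_erase_add_one (Finset.mem_filter.2 ⟨ha, hab⟩)
          have h2 : (F.erase b).filter (· < a) = F.filter (· < a) := by
            rw [Finset.filter_erase]
            exact Finset.erase_eq_of_notMem (by simp [hab.le])
          rw [Finset.erase_right_comm, ← Finsupp.single_add, h2, ← h1]
          rw [pow_succ]
          ring_nf
          simp
        rcases lt_or_gt_of_ne hwv with hlt | hlt
        · rw [add_comm]; exact aux w v hw hv hlt
        · exact aux v w hv hw hlt
      · rintro ⟨v, w⟩ h _ heq
        simp only [Finset.mem_sigma, Finset.mem_erase] at h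
        exact h.2.1 (congrArg Sigma.fst heq)
      · rintro ⟨v, w⟩ h
        simp only [Finset.mem_sigma, Finset.mem_erase] at h ⊢
        exact ⟨h.2.2, h.2.1.symm, h.1⟩
      · rintro ⟨v, w⟩ _
        rfl
    rw [key, smul_zero]

/-- The boundaries are cycles, so that the quotient below is the homology of a complex. -/
theorem boundaries_le_cycles (Δ : SimplComplex V) (i : ℤ) :
    Δ.boundaries K i ≤ Δ.cycles K i := by
  rintro _ ⟨x, hx, rfl⟩
  refine ⟨?_, boundary_boundary K x⟩
  have hle : Δ.chains K (i + 1) ≤ (Δ.chains K i).comap (boundary K) := by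
    rw [chains, Finsupp.supported_eq_span_single, Submodule.span_le]
    rintro _ ⟨F, ⟨hF, hc⟩, rfl⟩
    change boundary K (Finsupp.single F 1) ∈ Δ.chains K i
    rw [boundary_single]
    refine Submodule.smul_mem _ _ (Submodule.sum_mem _ fun v hv => ?_)
    refine Finsupp.single_mem_supported K _ ⟨Δ.down_closed _ hF _ (Finset.erase_subset v F), ?_⟩
    have := Finset.card_erase_add_one hv
    omega
  exact hle hx

/-- The reduced simplicial homology `H̃ᵢ(Δ; K)`: cycles modulo boundaries, for `i : ℤ`. -/
abbrev ReducedHomology (Δ : SimplComplex V) (i : ℤ) : Type _ :=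
  Subquotient (Δ.cycles K i) (Δ.boundaries K i)

end Homology

end SimplComplex

/-! The statement reduces to Reisner's criterion for one complex at a time. The link of `τ` in the
link of `σ` is the link of `τ ∪ σ`, so the links of faces with at least `t` vertices are closed
under taking links; by purity the link of `σ` has a face with `d - #σ` vertices. Two facts suffice.
(a) If `L` is Cohen–Macaulay and `F` is a face, reduced homology vanishes below degree `#F - 1`. (b)
If the faces of `L` have at most `e` vertices and the link of every `τ` has no cohomology below
degree `e - #τ - 1`, then `L` is Cohen–Macaulay.

Both rest on Koszul cohomology. A regular sequence of length `e` in the ideal of `z` kills it below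
degree `e`, and over a Noetherian local ring such vanishing yields a regular sequence. The Koszul
complex of the variables on `K[L]` is multigraded: its squarefree pieces are cochain complexes of
induced subcomplexes of `L`, the other pieces are cones (Hochster).

For (a), localize at the ideal of the variables, whose height is at least `#F`, and read off the
piece that is the cochain complex of `L` itself (`cohAcyclic_of_koszulDepthGE`). For (b),
Mayer–Vietoris passes from links to induced subcomplexes (`LinksAcyclic.restrict`), whence the
variables have Koszul depth at least `e` (`LinksAcyclic.koszulDepthGE`). Other maximal ideals need
not contain the variables, but they contain suitable polynomials `f v` in each `x_v`; these have the
same depth bound by induction along links (`LinksAcyclic.koszulDepthGE_aeval`). Since `dim K[L] ≤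
e`, depth equals dimension. -/

section KoszulSign

/-! ### Signs of exterior multiplication -/

variable {V : Type*} [LinearOrder V]

/-- The sign `(-1)ʲ` of the vertex `v` relative to `F`, where `j` is the number of elements of `F`
below `v`. -/
def koszulSign (F : Finset V) (v : V) : ℤ := (-1) ^ (F.filter (· < v)).card

theorem koszulSign_mul_self (F : Finset V) (v : V) : koszulSign F v * koszulSign F v = 1 := by
  rw [koszulSign, ← pow_add, ← two_mul, pow_mul]; simp

theorem koszulSign_erase_self (F : Finset V) (v : V) :
    koszulSign (F.erase v) v = koszulSign F v := by
  rw [koszulSign, koszulSign, Finset.filter_erase, Finset.erase_eq_of_notMem (by simp)]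

theorem koszulSign_insert_self (F : Finset V) (v : V) :
    koszulSign (insert v F) v = koszulSign F v := by
  rw [koszulSign, koszulSign, Finset.filter_insert, if_neg (lt_irrefl v)]

theorem koszulSign_union {N G : Finset V} (h : Disjoint N G) (v : V) :
    koszulSign (N ∪ G) v = koszulSign N v * koszulSign G v := by
  rw [koszulSign, koszulSign, koszulSign, Finset.filter_union, Finset.card_union_of_disjoint
    (Finset.disjoint_filter_filter h), pow_add]

theorem koszulSign_swap {F : Finset V} {v w : V} (hv : v ∈ F) (hw : w ∈ F) (hvw : v ≠ w) :
    koszulSign F v * koszulSign (F.erase v) w = -(koszulSign F w * koszulSign (F.erase w) v) := by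
  have aux : ∀ a b : V, a ∈ F → b ∈ F → a < b →
      koszulSign F a * koszulSign (F.erase a) b = -(koszulSign F b * koszulSign (F.erase b) a) := by
    intro a b ha hb hab
    have h1 : ((F.erase a).filter (· < b)).card + 1 = (F.filter (· < b)).card := by
      rw [Finset.filter_erase]
      exact Finset.card_erase_add_one (Finset.mem_filter.2 ⟨ha, hab⟩)
    have h2 : (F.erase b).filter (· < a) = F.filter (· < a) := by
      rw [Finset.filter_erase]
      exact Finset.erase_eq_of_notMem (by simp [hab.le])
    simp only [koszulSign]
    rw [h2, ← h1, pow_succ]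
    ring
  rcases lt_or_gt_of_ne hvw with h | h
  · exact aux v w hv hw h
  · rw [aux w v hw hv h, neg_neg]

theorem koszulSign_insert {F : Finset V} {v w : V} (hv : v ∉ F) (hw : w ∈ F) :
    koszulSign F v * koszulSign (insert v F) w =
      -(koszulSign F w * koszulSign (F.erase w) v) := by
  have hvw : v ≠ w := fun h => hv (h ▸ hw)
  have h := koszulSign_swap (Finset.mem_insert_self v F) (Finset.mem_insert_of_mem hw) hvw
  rw [Finset.erase_insert hv, koszulSign_insert_self, Finset.erase_insert_of_ne hvw,
    koszulSign_insert_self] at h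
  have h3 := koszulSign_mul_self (F.erase w) v
  have h4 := koszulSign_mul_self F v
  linear_combination (koszulSign F v * koszulSign (F.erase w) v) * h +
    (-koszulSign F v * koszulSign (insert v F) w) * h3 -
    (koszulSign F w * koszulSign (F.erase w) v) * h4

end KoszulSign

/-! ### Koszul cochains and their cohomology -/

section Koszul

variable {V : Type*} [LinearOrder V] {A M : Type*} [CommRing A] [AddCommGroup M] [Module A M]

/-- The differential of the Koszul cochain complex of the family `z` with coefficients in `M`:
left multiplication by `∑ v, z v e_v` on `⨁ F, M e_F`. -/
def koszulD (z : V → A) : (Finset V → M) →+ (Finset V → M) where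
  toFun c F := ∑ v ∈ F, koszulSign F v • z v • c (F.erase v)
  map_zero' := by ext; simp
  map_add' c c' := by ext; simp [Finset.sum_add_distrib]

theorem koszulD_apply (z : V → A) (c : Finset V → M) (F : Finset V) :
    koszulD z c F = ∑ v ∈ F, koszulSign F v • z v • c (F.erase v) := rfl

/-- Contraction with the basis vector dual to `e_v`. -/
def koszulContract (v : V) : (Finset V → M) →+ (Finset V → M) where
  toFun c F := if v ∈ F then 0 else koszulSign F v • c (insert v F)
  map_zero' := by ext; simp
  map_add' c c' := by ext F; by_cases h : v ∈ F <;> simp [h]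

theorem koszulContract_apply (v : V) (c : Finset V → M) (F : Finset V) :
    koszulContract v c F = if v ∈ F then 0 else koszulSign F v • c (insert v F) := rfl

theorem koszulD_smul (z : V → A) (a : A) (c : Finset V → M) :
    koszulD z (a • c) = a • koszulD z c := by
  ext F
  simp only [koszulD_apply, Pi.smul_apply, Finset.smul_sum]
  refine Finset.sum_congr rfl fun v _ => ?_
  rw [smul_comm (z v) a, smul_comm (koszulSign F v) a]

theorem koszulD_koszulD (z : V → A) (c : Finset V → M) : koszulD z (koszulD z c) = 0 := by
  ext F
  simp only [koszulD_apply, Finset.smul_sum, Pi.zero_apply]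
  rw [Finset.sum_sigma']
  refine Finset.sum_involution (fun p _ => ⟨p.2, p.1⟩) ?_ ?_ ?_ ?_
  · rintro ⟨v, w⟩ h
    simp only [Finset.mem_sigma, Finset.mem_erase] at h
    obtain ⟨hv, hwv, hw⟩ := h
    simp only
    rw [smul_comm (z v) (koszulSign _ _), smul_comm (z w) (koszulSign _ _),
      smul_smul (koszulSign _ _), smul_smul (koszulSign _ _), koszulSign_swap hv hw hwv.symm,
      Finset.erase_right_comm, smul_comm (z w) (z v), neg_smul, neg_add_cancel]
  · rintro ⟨v, w⟩ h _ heq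
    simp only [Finset.mem_sigma, Finset.mem_erase] at h
    exact h.2.1 (congrArg Sigma.fst heq)
  · rintro ⟨v, w⟩ h
    simp only [Finset.mem_sigma, Finset.mem_erase] at h ⊢
    exact ⟨h.2.2, h.2.1.symm, h.1⟩
  · rintro ⟨v, w⟩ _
    rfl

/-- Cartan's homotopy formula: the terms for vertices other than `v` vanish or cancel by
`koszulSign_insert`. Hence `z v` annihilates Koszul cohomology, with an explicit primitive. -/
theorem koszulD_contract (z : V → A) (v : V) (c : Finset V → M) :
    koszulD z (koszulContract v c) + koszulContract v (koszulD z c) = z v • c := by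
  ext F
  rw [Pi.add_apply, koszulContract_apply, koszulD_apply, Pi.smul_apply]
  by_cases hv : v ∈ F
  · rw [if_pos hv, add_zero, Finset.sum_eq_single_of_mem v hv]
    · rw [koszulContract_apply, if_neg (Finset.notMem_erase v F), koszulSign_erase_self,
        Finset.insert_erase hv, smul_comm (z v) (koszulSign F v), smul_smul, koszulSign_mul_self,
        one_smul]
    · intro w _ hwv
      rw [koszulContract_apply, if_pos (Finset.mem_erase.2 ⟨hwv.symm, hv⟩), smul_zero, smul_zero]
  · rw [if_neg hv, koszulD_apply, Finset.sum_insert hv, Finset.erase_insert hv,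
      koszulSign_insert_self, smul_add, smul_smul, koszulSign_mul_self, one_smul, add_left_comm,
      Finset.smul_sum, ← Finset.sum_add_distrib, Finset.sum_eq_zero, add_zero]
    intro w hw
    have hvw : v ≠ w := fun h => hv (h ▸ hw)
    rw [koszulContract_apply, if_neg (fun h => hv (Finset.mem_of_mem_erase h)),
      Finset.erase_insert_of_ne hvw, smul_smul (koszulSign F v), koszulSign_insert hv hw,
      smul_comm (z w) (koszulSign _ v), smul_smul, neg_smul, add_neg_cancel]

theorem koszulD_map {A' M' : Type*} [CommRing A'] [AddCommGroup M'] [Module A' M']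
    {z : V → A} {z' : V → A'} (φ : M →+ M') (hφ : ∀ v m, φ (z v • m) = z' v • φ m)
    (c : Finset V → M) : koszulD z' (fun F => φ (c F)) = fun F => φ (koszulD z c F) := by
  ext F
  simp only [koszulD_apply, map_sum, map_zsmul, hφ]

theorem koszulD_algebraMap {B S : Type*} [CommRing B] [CommRing S] [Algebra B S] (z : V → B)
    (c : Finset V → B) : koszulD (fun v => algebraMap B S (z v)) (fun F => algebraMap B S (c F)) =
      fun F => algebraMap B S (koszulD z c F) :=
  koszulD_map (algebraMap B S).toAddMonoidHom (fun v m => by simp) c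

/-- Truncation of a cochain to degrees below `k`. -/
theorem koszulD_truncate (z : V → A) (k : ℕ) (c : Finset V → M) :
    koszulD z (fun F => if F.card < k then c F else 0) =
      fun F => if F.card < k + 1 then koszulD z c F else 0 := by
  ext F
  rw [koszulD_apply]
  split_ifs with h
  · refine Finset.sum_congr rfl fun v hv => ?_
    have := Finset.card_erase_add_one hv
    rw [if_pos (by omega)]
  · refine Finset.sum_eq_zero fun v hv => ?_
    have := Finset.card_erase_add_one hv
    rw [if_neg (by omega), smul_zero, smul_zero]

variable (M) in
/-- The Koszul cohomology of `z` with coefficients in `M` vanishes in degrees below `e`. -/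
def KoszulDepthGE (z : V → A) (e : ℕ) : Prop :=
  ∀ c : Finset V → M, (∀ F, e ≤ F.card → c F = 0) → koszulD z c = 0 → ∃ b, koszulD z b = c

theorem KoszulDepthGE.exists_truncated {z : V → A} {e : ℕ} (h : KoszulDepthGE M z (e + 1))
    {c : Finset V → M} (hc : ∀ F, e + 1 ≤ F.card → c F = 0) (hd : koszulD z c = 0) :
    ∃ b : Finset V → M, (∀ F, e ≤ F.card → b F = 0) ∧ koszulD z b = c := by
  obtain ⟨b, hb⟩ := h c hc hd
  refine ⟨fun F => if F.card < e then b F else 0, fun F hF => if_neg hF.not_gt, ?_⟩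
  rw [koszulD_truncate]
  ext F
  split_ifs with hF
  · rw [hb]
  · rw [hc F (not_lt.1 hF)]

theorem koszulDepthGE_zero (z : V → A) : KoszulDepthGE M z 0 := fun c hc _ =>
  ⟨0, by rw [map_zero]; ext F; exact (hc F (Nat.zero_le _)).symm⟩

theorem KoszulDepthGE.mono {z : V → A} {e e' : ℕ} (h : KoszulDepthGE M z e) (hle : e' ≤ e) :
    KoszulDepthGE M z e' := fun c hc => h c fun F hF => hc F (hle.trans hF)

theorem KoszulDepthGE.of_addEquiv {A' M' : Type*} [CommRing A'] [AddCommGroup M'] [Module A' M']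
    {z : V → A} {z' : V → A'} {e : ℕ} (φ : M ≃+ M') (hφ : ∀ v m, φ (z v • m) = z' v • φ m)
    (h : KoszulDepthGE M' z' e) : KoszulDepthGE M z e := by
  intro c hc hd
  obtain ⟨b, hb⟩ := h (fun F => φ (c F)) (fun F hF => by rw [hc F hF, map_zero]) (by
    have := koszulD_map φ.toAddMonoidHom hφ c
    ext F
    simpa [hd] using congrFun this F)
  refine ⟨fun F => φ.symm (b F), ?_⟩
  have := koszulD_map (z := z') (z' := z) φ.symm.toAddMonoidHom (fun v m => by
    apply φ.injective; simp [hφ]) b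
  ext F
  simpa [hb] using congrFun this F

theorem KoszulDepthGE.pi {ι : Type*} {z : V → A} {e : ℕ} (h : KoszulDepthGE M z e) :
    KoszulDepthGE (ι → M) z e := by
  intro c hc hd
  have key : ∀ i (c : Finset V → ι → M),
      koszulD z (fun F => c F i) = fun F => koszulD z c F i := fun i c =>
    koszulD_map (Pi.evalAddMonoidHom (fun _ : ι => M) i) (fun _ _ => rfl) c
  choose b hb using fun i => h (fun F => c F i) (fun F hF => by rw [hc F hF]; rfl)
    (by rw [key, hd]; rfl)
  refine ⟨fun F i => b i F, ?_⟩
  ext F i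
  rw [← congrFun (key i _) F, hb]

end Koszul

/-! ### Koszul depth and regular sequences -/

section Depth

open scoped Pointwise

variable {V : Type*} [LinearOrder V] {A M : Type*} [CommRing A] [AddCommGroup M] [Module A M]

theorem QuotSMulTop.exists_smul_eq {y : A} {m : M}
    (h : Submodule.Quotient.mk (p := y • (⊤ : Submodule A M)) m = 0) : ∃ m' : M, y • m' = m := by
  rw [Submodule.Quotient.mk_eq_zero] at h
  obtain ⟨m', _, hm'⟩ := h
  exact ⟨m', hm'⟩

theorem QuotSMulTop.mk_smul_eq_zero (y : A) (m : M) :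
    Submodule.Quotient.mk (p := y • (⊤ : Submodule A M)) (y • m) = 0 := by
  rw [Submodule.Quotient.mk_eq_zero]
  exact Submodule.smul_mem_pointwise_smul _ _ _ Submodule.mem_top

theorem koszulD_quotMk (z : V → A) (y : A) (c : Finset V → M) :
    koszulD z (fun F => (Submodule.Quotient.mk (c F) : QuotSMulTop y M)) =
      fun F => Submodule.Quotient.mk (koszulD z c F) :=
  koszulD_map (Submodule.mkQ (y • (⊤ : Submodule A M))).toAddMonoidHom (fun _ _ => rfl) c

/-- If `y` lies in the ideal generated by the family `z`, then `y` annihilates the Koszul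
cohomology, by a homotopy that lowers degrees. -/
theorem exists_koszul_homotopy [Fintype V] {z : V → A} {y : A} (hy : y ∈ Ideal.span (Set.range z))
    {e : ℕ} {c : Finset V → M} (hc : ∀ F, e + 1 ≤ F.card → c F = 0) (hd : koszulD z c = 0) :
    ∃ w : Finset V → M, (∀ F, e ≤ F.card → w F = 0) ∧ koszulD z w = y • c := by
  obtain ⟨a, rfl⟩ := Ideal.mem_span_range_iff_exists_fun.1 hy
  refine ⟨∑ v, a v • koszulContract v c, ?_, ?_⟩
  · intro F hF
    rw [Finset.sum_apply]
    refine Finset.sum_eq_zero fun v _ => ?_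
    rw [Pi.smul_apply, koszulContract_apply]
    split_ifs with hv
    · rw [smul_zero]
    · rw [hc _ (by rw [Finset.card_insert_of_notMem hv]; omega), smul_zero, smul_zero]
  · rw [map_sum, Finset.sum_smul]
    refine Finset.sum_congr rfl fun v _ => ?_
    rw [koszulD_smul, mul_smul]
    have := koszulD_contract z v c
    rw [hd, map_zero, add_zero] at this
    rw [this]

/-- For a cocycle `c`, the homotopy gives `y c = d w` with `w` one degree lower. Modulo `y` this `w`
is a cocycle, so `w = d u + y w'`; then `y d w' = y c`, and cancelling `y` gives `d w' = c`. -/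
theorem KoszulDepthGE.of_quotSMulTop [Fintype V] {z : V → A} {y : A}
    (hy : y ∈ Ideal.span (Set.range z)) (hreg : IsSMulRegular M y) {e : ℕ}
    (h : KoszulDepthGE (QuotSMulTop y M) z e) : KoszulDepthGE M z (e + 1) := by
  intro c hc hd
  obtain ⟨w, hw, hdw⟩ := exists_koszul_homotopy hy hc hd
  obtain ⟨u, hu⟩ := h (fun F => Submodule.Quotient.mk (w F))
    (fun F hF => by rw [hw F hF, Submodule.Quotient.mk_zero])
    (by
      rw [koszulD_quotMk, hdw]
      ext F
      exact QuotSMulTop.mk_smul_eq_zero _ _)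
  choose u' hu' using fun F => Submodule.Quotient.mk_surjective _ (u F)
  obtain rfl : (fun F => Submodule.Quotient.mk (u' F)) = u := funext hu'
  rw [koszulD_quotMk] at hu
  choose w' hw' using fun F => QuotSMulTop.exists_smul_eq (y := y) (m := w F - koszulD z u' F)
    (by rw [Submodule.Quotient.mk_sub, sub_eq_zero]; exact (congrFun hu F).symm)
  have hw'' : y • w' = w - koszulD z u' := funext hw'
  refine ⟨w', ?_⟩
  have : y • koszulD z w' = y • c := by
    rw [← koszulD_smul, hw'', map_sub, koszulD_koszulD, sub_zero, hdw]
  ext F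
  exact hreg (congrFun this F)

/-- The long exact sequence of `0 → M → M → M/yM → 0`, unwound: a cocycle modulo `y` lifts to `c'`
with `d c' = y w`. Here `w` is a cocycle one degree higher, so `w = d u`, and `c' - y u` is a
cocycle of `M` with the same class modulo `y`. -/
theorem KoszulDepthGE.quotSMulTop {z : V → A} {y : A} (hreg : IsSMulRegular M y) {e : ℕ}
    (h : KoszulDepthGE M z (e + 1)) : KoszulDepthGE (QuotSMulTop y M) z e := by
  intro c hc hd
  have hlift : ∀ F, ∃ m : M, (Submodule.Quotient.mk m : QuotSMulTop y M) = c F ∧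
      (e ≤ F.card → m = 0) := by
    intro F
    by_cases hF : e ≤ F.card
    · exact ⟨0, by rw [hc F hF, Submodule.Quotient.mk_zero], fun _ => rfl⟩
    · obtain ⟨m, hm⟩ := Submodule.Quotient.mk_surjective _ (c F)
      exact ⟨m, hm, fun h => absurd h hF⟩
  choose c' hc' hsupp using hlift
  obtain rfl : (fun F => Submodule.Quotient.mk (c' F)) = c := funext hc'
  rw [koszulD_quotMk] at hd
  choose w hw using fun F => QuotSMulTop.exists_smul_eq (congrFun hd F)
  have hw' : y • w = koszulD z c' := funext hw
  have hwsupp : ∀ F, e + 1 ≤ F.card → w F = 0 := by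
    intro F hF
    apply hreg
    change y • w F = y • (0 : M)
    rw [hw, smul_zero, koszulD_apply]
    refine Finset.sum_eq_zero fun v hv => ?_
    have := Finset.card_erase_add_one hv
    rw [hsupp _ (by omega), smul_zero, smul_zero]
  have hdw : koszulD z w = 0 := by
    ext F
    apply hreg
    change (y • koszulD z w) F = y • (0 : M)
    rw [← koszulD_smul, hw', koszulD_koszulD, smul_zero, Pi.zero_apply]
  obtain ⟨u, husupp, hu⟩ := h.exists_truncated hwsupp hdw
  obtain ⟨b, hb⟩ := h (c' - y • u) (fun F hF => by
      rw [Pi.sub_apply, Pi.smul_apply, hsupp F (by omega), husupp F (by omega), smul_zero,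
        sub_zero])
    (by rw [map_sub, koszulD_smul, hu, hw', sub_self])
  refine ⟨fun F => Submodule.Quotient.mk (b F), ?_⟩
  rw [koszulD_quotMk, hb]
  ext F
  rw [Pi.sub_apply, Submodule.Quotient.mk_sub, Pi.smul_apply]
  erw [QuotSMulTop.mk_smul_eq_zero]
  rw [sub_zero]

/-- Regular sequences in the ideal generated by `z` bound the Koszul depth from below. -/
theorem RingTheory.Sequence.IsWeaklyRegular.koszulDepthGE [Fintype V] {z : V → A} {rs : List A}
    (hrs : ∀ r ∈ rs, r ∈ Ideal.span (Set.range z))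
    (h : RingTheory.Sequence.IsWeaklyRegular M rs) : KoszulDepthGE M z rs.length := by
  induction rs generalizing M with
  | nil => exact koszulDepthGE_zero z
  | cons r rs ih =>
    rw [RingTheory.Sequence.isWeaklyRegular_cons_iff] at h
    exact KoszulDepthGE.of_quotSMulTop (hrs r List.mem_cons_self) h.1
      (ih (fun r' hr' => hrs r' (List.mem_cons_of_mem _ hr')) h.2)

/-- Over a Noetherian local ring, Koszul depth is realised by a regular sequence. -/
theorem KoszulDepthGE.exists_isWeaklyRegular [IsLocalRing A] [IsNoetherianRing A]
    [Module.Finite A M] {z : V → A} (hz : ∀ v, z v ∈ IsLocalRing.maximalIdeal A) {e : ℕ}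
    (h : KoszulDepthGE M z e) :
    ∃ rs : List A, (∀ r ∈ rs, r ∈ IsLocalRing.maximalIdeal A) ∧
      RingTheory.Sequence.IsWeaklyRegular M rs ∧ rs.length = e := by
  induction e generalizing M with
  | zero => exact ⟨[], by simp, RingTheory.Sequence.IsWeaklyRegular.nil A M, rfl⟩
  | succ e ih =>
    obtain ⟨y, hy, hreg⟩ : ∃ y ∈ IsLocalRing.maximalIdeal A, IsSMulRegular M y := by
      by_contra! hcon
      -- Prime avoidance: if all of the maximal ideal consists of zero divisors, it lies in the
      -- annihilator of a nonzero element `m`.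
      have hsub : (IsLocalRing.maximalIdeal A : Set A) ⊆ ⋃ p ∈ associatedPrimes A M, p := by
        rw [biUnion_associatedPrimes_eq_compl_regular]
        exact fun y hy => hcon y hy
      obtain ⟨p, hp, hle⟩ := (Ideal.subset_union_prime_finite (associatedPrimes.finite A M) 0 0
        (fun p hp _ _ => hp.isPrime)).1 hsub
      obtain ⟨hprime, m, rfl⟩ := isAssociatedPrime_iff.1 hp
      have hkill : ∀ v, z v • m = 0 := fun v => by
        simpa [Submodule.mem_colon_singleton] using hle (hz v)
      have hm0 : m ≠ 0 := by
        rintro rfl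
        exact hprime.ne_top (by simp)
      -- The element `m` in degree 0 is a cocycle, but every coboundary is an empty sum at `∅`.
      obtain ⟨b, hb⟩ := h (fun F => if F = ∅ then m else 0) (fun F hF => by
        rw [if_neg]; rintro rfl; simp at hF) (by
        ext F
        rw [koszulD_apply]
        refine Finset.sum_eq_zero fun v _ => ?_
        split_ifs
        · rw [hkill, smul_zero]
        · rw [smul_zero, smul_zero])
      have := congrFun hb ∅
      rw [koszulD_apply, Finset.sum_empty, if_pos rfl] at this
      exact hm0 this.symm
    obtain ⟨rs, hmem, hrs, hlen⟩ := ih (h.quotSMulTop hreg)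
    exact ⟨y :: rs, by simpa using ⟨hy, hmem⟩, hrs.cons hreg, by simp [hlen]⟩

theorem KoszulDepthGE.localization [Fintype V] {S B : Type*} [CommRing B] [CommRing S]
    [Algebra B S] (T : Submonoid B) [IsLocalization T S] {z : V → B} {e : ℕ}
    (h : KoszulDepthGE B z e) : KoszulDepthGE S (fun v => algebraMap B S (z v)) e := by
  intro c hc hd
  obtain ⟨s, hs⟩ := IsLocalization.exist_integer_multiples_of_finite T c
  choose c' hc' using hs
  -- After clearing denominators, the cocycle and support conditions hold only up to torsion by `T`;
  -- the product of all the `t F` restores both.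
  have hkill : ∀ F, ∃ t : T, (t : B) * koszulD z c' F = 0 ∧ (e ≤ F.card → (t : B) * c' F = 0) := by
    intro F
    have h1 : algebraMap B S (koszulD z c' F) = 0 := by
      rw [← congrFun (koszulD_algebraMap z c') F]
      have : (fun F => algebraMap B S (c' F)) = algebraMap B S (s : B) • c := by
        ext F; rw [hc', Algebra.smul_def]; rfl
      rw [this, koszulD_smul, hd, smul_zero, Pi.zero_apply]
    obtain ⟨t, ht⟩ := (IsLocalization.map_eq_zero_iff T S _).1 h1
    by_cases hF : e ≤ F.card
    · have h2 : algebraMap B S (c' F) = 0 := by rw [hc', hc F hF, smul_zero]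
      obtain ⟨t', ht'⟩ := (IsLocalization.map_eq_zero_iff T S _).1 h2
      exact ⟨t * t', by rw [Submonoid.coe_mul, mul_right_comm, ht, zero_mul],
        fun _ => by rw [Submonoid.coe_mul, mul_assoc, ht', mul_zero]⟩
    · exact ⟨t, ht, fun h => absurd h hF⟩
  choose t ht ht' using hkill
  have hprod : ∀ F, t F ∣ ∏ G, t G := fun F => Finset.dvd_prod_of_mem _ (Finset.mem_univ F)
  have hzero : ∀ F (x : B), (t F : B) * x = 0 → ((∏ G, t G : T) : B) * x = 0 := by
    intro F x hx
    obtain ⟨q, hq⟩ := hprod F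
    rw [hq, Submonoid.coe_mul, mul_right_comm, hx, zero_mul]
  obtain ⟨b, hb⟩ := h (((∏ G, t G : T) : B) • c') (fun F hF => hzero F _ (ht' F hF)) (by
    rw [koszulD_smul]
    ext F
    exact hzero F _ (ht F))
  have hu : IsUnit (algebraMap B S ((∏ G, t G : T) * s : T)) := IsLocalization.map_units S _
  refine ⟨(↑hu.unit⁻¹ : S) • fun F => algebraMap B S (b F), ?_⟩
  rw [koszulD_smul, koszulD_algebraMap, hb]
  ext F
  simp only [Pi.smul_apply, smul_eq_mul, map_mul, hc', Algebra.smul_def]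
  rw [← mul_assoc (algebraMap B S _), ← map_mul, ← Submonoid.coe_mul, ← mul_assoc,
    hu.val_inv_mul, one_mul]

end Depth

/-! ### Acyclicity of simplicial cochains -/

section CohAcyclic

variable {V : Type*} [LinearOrder V] (K : Type*) [Field K]

/-- The simplicial cochain complex of the family `𝓛` of finite sets with coefficients in `K` has
no cohomology on sets with fewer than `k` elements. -/
def CohAcyclic (𝓛 : Set (Finset V)) (k : ℕ) : Prop :=
  ∀ γ : Finset V → K, (∀ F, k ≤ F.card → γ F = 0) →
    (∀ G ∈ 𝓛, koszulD (1 : V → K) γ G = 0) →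
      ∃ β : Finset V → K, ∀ G ∈ 𝓛, koszulD (1 : V → K) β G = γ G

variable {K}

theorem cohAcyclic_zero (𝓛 : Set (Finset V)) : CohAcyclic K 𝓛 0 := fun γ hγ _ =>
  ⟨0, fun G _ => by rw [map_zero, hγ G (Nat.zero_le _), Pi.zero_apply]⟩

theorem cohAcyclic_of_isEmpty {𝓛 : Set (Finset V)} (h : ∀ G, G ∉ 𝓛) (k : ℕ) : CohAcyclic K 𝓛 k :=
  fun _ _ _ => ⟨0, fun G hG => absurd hG (h G)⟩

theorem CohAcyclic.exists_truncated {𝓛 : Set (Finset V)} {k : ℕ} (h : CohAcyclic K 𝓛 k)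
    {γ : Finset V → K} (hγ : ∀ F, k ≤ F.card → γ F = 0)
    (hd : ∀ G ∈ 𝓛, koszulD (1 : V → K) γ G = 0) :
    ∃ β : Finset V → K, (∀ F, k ≤ F.card → β F = 0) ∧
      ∀ G ∈ 𝓛, koszulD (1 : V → K) β G = γ G := by
  obtain ⟨β, hβ⟩ := h γ hγ hd
  refine ⟨fun F => if F.card < k then β F else 0, fun F hF => if_neg hF.not_gt, fun G hG => ?_⟩
  rw [koszulD_truncate]
  dsimp only
  split_ifs with hF
  · exact hβ G hG
  · rw [hγ G (by omega)]

/-- The Mayer–Vietoris argument for the deletion of a vertex. -/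
theorem CohAcyclic.deletion {𝓛 : Set (Finset V)} {v : V} {k : ℕ}
    (hdown : ∀ G, insert v G ∈ 𝓛 → G ∈ 𝓛) (hL : CohAcyclic K 𝓛 (k + 1))
    (hlk : CohAcyclic K {G | v ∉ G ∧ insert v G ∈ 𝓛} k) :
    CohAcyclic K {G | v ∉ G ∧ G ∈ 𝓛} k := by
  intro γ hγ hd
  obtain ⟨β, hβsupp, hβ⟩ := hlk.exists_truncated hγ fun G hG => hd G ⟨hG.1, hdown G hG.2⟩
  -- On the link of `v` the cocycle `γ` has a primitive `β`. Placing `β`, with signs, on the faces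
  -- through `v` extends `γ` to a cocycle on all of `𝓛`; a primitive of the extension restricts to
  -- one of `γ`.
  obtain ⟨η, hη⟩ := hL
    (fun F => if v ∈ F then koszulSign F v • β (F.erase v) else γ F)
    (by
      intro F hF
      split_ifs with hv
      · have := Finset.card_erase_add_one hv
        rw [hβsupp _ (by omega), smul_zero]
      · exact hγ F (by omega))
    (by
      intro G hG
      by_cases hv : v ∈ G
      · obtain ⟨H, hvH, rfl⟩ : ∃ H, v ∉ H ∧ insert v H = G :=
          ⟨G.erase v, Finset.notMem_erase v G, Finset.insert_erase hv⟩
        have h1 := hβ H ⟨hvH, hG⟩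
        rw [koszulD_apply, Finset.sum_insert hvH, Finset.erase_insert hvH, if_neg hvH, ← h1,
          koszulSign_insert_self, koszulD_apply, Finset.smul_sum, Finset.smul_sum,
          ← Finset.sum_add_distrib]
        refine Finset.sum_eq_zero fun w hw => ?_
        have hvw : v ≠ w := fun h => hvH (h ▸ hw)
        have hnot : v ∉ H.erase w := fun h => hvH (Finset.mem_of_mem_erase h)
        rw [Finset.erase_insert_of_ne hvw, if_pos (Finset.mem_insert_self _ _),
          Finset.erase_insert hnot, koszulSign_insert_self]
        simp only [Pi.one_apply, one_smul, smul_smul]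
        have h2 := koszulSign_insert hvH hw
        have h3 := koszulSign_mul_self (H.erase w) v
        have h4 := koszulSign_mul_self H v
        rw [← add_smul]
        have : koszulSign H v * koszulSign H w +
            koszulSign (insert v H) w * koszulSign (H.erase w) v = 0 := by
          linear_combination (koszulSign H v * koszulSign (H.erase w) v) * h2 -
            (koszulSign H v * koszulSign H w) * h3 -
            (koszulSign (insert v H) w * koszulSign (H.erase w) v) * h4
        rw [this, zero_smul]
      · rw [← hd G ⟨hv, hG⟩, koszulD_apply, koszulD_apply]
        refine Finset.sum_congr rfl fun w _ => ?_
        rw [if_neg fun h => hv (Finset.mem_of_mem_erase h)])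
  exact ⟨η, fun G hG => by rw [hη G hG.2, if_neg hG.1]⟩

/-- Contraction with the apex `v` is a contracting homotopy. -/
theorem CohAcyclic.of_cone {𝓛 : Set (Finset V)} {z : V → K} {v : V} (hz : z v = 1)
    (hcone : ∀ G ∈ 𝓛, insert v G ∈ 𝓛) {γ : Finset V → K}
    (hd : ∀ G ∈ 𝓛, koszulD z γ G = 0) : ∃ β : Finset V → K, ∀ G ∈ 𝓛, koszulD z β G = γ G := by
  refine ⟨koszulContract v γ, fun G hG => ?_⟩
  have := congrFun (koszulD_contract z v γ) G
  rw [Pi.add_apply, koszulContract_apply v (koszulD z γ), hd _ (hcone G hG), smul_zero, ite_self,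
    add_zero, hz, one_smul] at this
  exact this

end CohAcyclic

/-! ### Acyclic links and induced subcomplexes -/

namespace SimplComplex

variable {V : Type*} [LinearOrder V] (K : Type*) [Field K]

/-- All links of `L` (including `L` itself) have vanishing cohomology below the degree that is
expected for a Cohen–Macaulay complex of dimension `e - 1`. -/
def LinksAcyclic (L : SimplComplex V) (e : ℕ) : Prop :=
  ∀ τ : Finset V, CohAcyclic K {G | Disjoint G τ ∧ G ∪ τ ∈ L} (e - τ.card)

variable {K}

/-- Vertices of `N` are deleted one at a time, each costing one degree by Mayer–Vietoris. The
induction needs all `τ` at once, because the link of `v` after deleting `N` from the link of `τ` is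
the deletion of `N` from the link of `insert v τ`. -/
theorem LinksAcyclic.restrict {L : SimplComplex V} {e : ℕ} (h : L.LinksAcyclic K e)
    (N : Finset V) : ∀ τ : Finset V, Disjoint N τ →
      CohAcyclic K {G | Disjoint G N ∧ Disjoint G τ ∧ G ∪ τ ∈ L} (e - τ.card - N.card) := by
  induction N using Finset.induction_on with
  | empty => intro τ _; simpa using h τ
  | insert v N hv ih =>
    intro τ hτ
    rw [Finset.disjoint_insert_left] at hτ
    rw [Finset.card_insert_of_notMem hv]
    -- The bounds use truncated subtraction; once the bound reaches zero nothing is claimed.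
    rcases Nat.eq_zero_or_pos (e - τ.card - N.card) with h0 | h0
    · rw [show e - τ.card - (N.card + 1) = 0 by omega]
      exact cohAcyclic_zero _
    have h1 := ih τ hτ.2
    have h2 := ih (insert v τ) (Finset.disjoint_insert_right.2 ⟨hv, hτ.2⟩)
    rw [Finset.card_insert_of_notMem hτ.1] at h2
    rw [show e - τ.card - N.card = e - τ.card - (N.card + 1) + 1 by omega] at h1
    rw [show e - (τ.card + 1) - N.card = e - τ.card - (N.card + 1) by omega] at h2
    have h3 := h1.deletion (v := v) (fun G hG => by
      simp only [Set.mem_ofPred_eq, Finset.disjoint_insert_left, Finset.insert_union] at hG ⊢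
      exact ⟨hG.1.2, hG.2.1.2, L.down_closed _ hG.2.2 _ (Finset.subset_insert _ _)⟩) (by
      convert h2 using 1
      ext G
      simp only [Set.mem_ofPred_eq, Finset.disjoint_insert_left, Finset.disjoint_insert_right,
        Finset.insert_union, Finset.union_insert]
      tauto)
    convert h3 using 1
    ext G
    simp only [Set.mem_ofPred_eq, Finset.disjoint_insert_right]
    tauto

theorem mem_link {L : SimplComplex V} {σ : Finset V} (hσ : σ ∈ L) {τ : Finset V} :
    τ ∈ L.link σ hσ ↔ τ ∪ σ ∈ L ∧ Disjoint τ σ := by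
  change τ ∈ L.faces.filter _ ↔ _
  rw [Finset.mem_filter, Finset.disjoint_iff_inter_eq_empty]
  exact ⟨fun h => h.2, fun h => ⟨L.down_closed _ h.1 _ Finset.subset_union_left, h⟩⟩

theorem LinksAcyclic.link_singleton {L : SimplComplex V} {e : ℕ} (h : L.LinksAcyclic K e) {v : V}
    (hv : {v} ∈ L) : (L.link {v} hv).LinksAcyclic K (e - 1) := by
  intro τ
  by_cases hvτ : v ∈ τ
  · refine cohAcyclic_of_isEmpty (fun G hG => ?_) _
    have := ((mem_link hv).1 hG.2).2
    rw [Finset.disjoint_singleton_right] at this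
    exact this (Finset.mem_union_right _ hvτ)
  · have := h (insert v τ)
    rw [Finset.card_insert_of_notMem hvτ] at this
    rw [show e - 1 - τ.card = e - (τ.card + 1) by omega]
    convert this using 1
    ext G
    simp only [Set.mem_ofPred_eq, mem_link, Finset.disjoint_singleton_right, Finset.mem_union,
      Finset.disjoint_insert_right, Finset.union_insert, Finset.union_assoc,
      Finset.union_comm τ {v}, Finset.singleton_union]
    tauto

/-! ### Duality between homology and cohomology -/

section Duality

theorem linearCombination_boundary (β : Finset V → K) (x : Finset V →₀ K) :
    Finsupp.linearCombination K β (boundary K x) =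
      Finsupp.linearCombination K (koszulD (1 : V → K) β) x := by
  induction x using Finsupp.induction_linear with
  | zero => simp
  | add f g hf hg => simp only [map_add, hf, hg]
  | single F c =>
    rw [boundary_single, map_smul, map_sum, Finsupp.linearCombination_single, koszulD_apply]
    congr 1
    refine Finset.sum_congr rfl fun v _ => ?_
    rw [Finsupp.linearCombination_single]
    simp [koszulSign]

theorem boundary_filter_card (p : ℕ) (x : Finset V →₀ K) :
    boundary K (x.filter fun F => F.card = p) =
      (boundary K x).filter fun F => F.card + 1 = p := by
  induction x using Finsupp.induction_linear with
  | zero => rw [Finsupp.filter_zero, map_zero, Finsupp.filter_zero]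
  | add f g hf hg => rw [Finsupp.filter_add, map_add, map_add, Finsupp.filter_add, hf, hg]
  | single F c =>
    by_cases h : F.card = p
    · rw [Finsupp.filter_single_of_pos (fun F : Finset V => F.card = p) h,
        (Finsupp.filter_eq_self_iff _ _).2]
      intro G hG
      by_contra hcard
      apply hG
      rw [boundary_single, Finsupp.smul_apply, Finsupp.finsetSum_apply, Finset.sum_eq_zero,
        smul_zero]
      intro v hv
      rw [Finsupp.single_apply, if_neg]
      rintro rfl
      exact hcard (by rw [Finset.card_erase_add_one hv, h])
    · rw [Finsupp.filter_single_of_neg (fun F : Finset V => F.card = p) h, map_zero]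
      symm
      rw [Finsupp.filter_eq_zero_iff]
      intro G hG
      rw [boundary_single, Finsupp.smul_apply, Finsupp.finsetSum_apply, Finset.sum_eq_zero,
        smul_zero]
      intro v hv
      rw [Finsupp.single_apply, if_neg]
      rintro rfl
      exact h (by rw [← hG, Finset.card_erase_add_one hv])

theorem subsingleton_reducedHomology_iff (L : SimplComplex V) (i : ℤ) :
    Subsingleton (L.ReducedHomology K i) ↔ L.cycles K i ≤ L.boundaries K i := by
  exact (Submodule.Quotient.subsingleton_iff).trans Submodule.submoduleOf_eq_top

/-- Over a field the range of a dual map is the annihilator of the kernel. With `f` the boundary,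
this turns a cochain that vanishes on cycles into a coboundary. -/
theorem exists_dual_factor {E E' : Type*} [AddCommGroup E] [Module K E] [AddCommGroup E']
    [Module K E'] (C : Submodule K E) (f : E →ₗ[K] E') (g : E →ₗ[K] K)
    (h : ∀ x ∈ C, f x = 0 → g x = 0) : ∃ l : E' →ₗ[K] K, ∀ x ∈ C, l (f x) = g x := by
  have hker : g ∘ₗ C.subtype ∈ (LinearMap.ker (f ∘ₗ C.subtype)).dualAnnihilator := by
    rw [Submodule.mem_dualAnnihilator]
    exact fun x hx => h x x.2 hx
  obtain ⟨l, hl⟩ := (LinearMap.range_dualMap_eq_dualAnnihilator_ker _).ge hker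
  exact ⟨l, fun x hx => LinearMap.congr_fun hl ⟨x, hx⟩⟩

theorem cohAcyclic_of_homology [Fintype V] {L : SimplComplex V} {e : ℕ}
    (h : ∀ i : ℤ, i < (e : ℤ) - 1 → Subsingleton (L.ReducedHomology K i)) :
    CohAcyclic K {G | G ∈ L} e := by
  intro γ hγ hd
  obtain ⟨l, hl⟩ := exists_dual_factor (Finsupp.supported K K {F | F ∈ L}) (boundary K)
    (Finsupp.linearCombination K γ) (by
    intro x hx hbx
    -- A cycle is split by cardinality. Parts with `p < e` are boundaries, which pair to zero with
    -- the cocycle `γ`; on the others `γ` itself vanishes.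
    have hsum : x = ∑ p ∈ Finset.range (Fintype.card V + 1), x.filter fun F => F.card = p := by
      ext F
      have := Finset.card_le_univ F
      simp only [Finsupp.finsetSum_apply, Finsupp.filter_apply]
      rw [Finset.sum_ite_eq, if_pos (Finset.mem_range.2 (by omega))]
    rw [hsum, map_sum]
    refine Finset.sum_eq_zero fun p _ => ?_
    by_cases hp : p < e
    · have hcyc : (x.filter fun F => F.card = p) ∈ L.cycles K ((p : ℤ) - 1) := by
        refine ⟨?_, ?_⟩
        · intro F hF
          rw [Finset.mem_coe, Finsupp.support_filter, Finset.mem_filter] at hF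
          exact ⟨hx hF.1, by rw [hF.2]; ring⟩
        · rw [SetLike.mem_coe, LinearMap.mem_ker, boundary_filter_card, hbx, Finsupp.filter_zero]
      obtain ⟨y, hy, hxy⟩ := (subsingleton_reducedHomology_iff L _).1 (h _ (by omega)) hcyc
      rw [← hxy, linearCombination_boundary, Finsupp.linearCombination_apply, Finsupp.sum]
      refine Finset.sum_eq_zero fun F hF => ?_
      rw [hd F (hy hF).1, smul_zero]
    · rw [Finsupp.linearCombination_apply, Finsupp.sum]
      refine Finset.sum_eq_zero fun F hF => ?_
      rw [Finsupp.support_filter, Finset.mem_filter] at hF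
      rw [hγ F (by omega), smul_zero])
  refine ⟨fun F => l (Finsupp.single F 1), fun G hG => ?_⟩
  have h1 : l (boundary K (Finsupp.single G 1)) = γ G := by
    rw [hl _ (Finsupp.single_mem_supported K _ hG)]
    simp
  have h2 : l = Finsupp.linearCombination K fun F => l (Finsupp.single F 1) := by
    ext F; simp
  rw [← h1, h2, linearCombination_boundary]
  simp

theorem homology_of_cohAcyclic {L : SimplComplex V} {e : ℕ} (h : CohAcyclic K {G | G ∈ L} e)
    {i : ℤ} (hi : i < (e : ℤ) - 1) : Subsingleton (L.ReducedHomology K i) := by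
  rw [subsingleton_reducedHomology_iff]
  intro x hx
  by_contra hnot
  -- A functional that separates `x` from the boundaries is a cocycle, hence some `δβ` on faces with
  -- `i + 1` vertices; but then `l x` is the pairing of `β` with the boundary of `x`, which is zero.
  obtain ⟨l, hlx, hl⟩ := Submodule.exists_le_ker_of_notMem hnot
  obtain ⟨β, hβ⟩ := h (fun F => if (F.card : ℤ) = i + 1 then l (Finsupp.single F 1) else 0)
    (fun F hF => if_neg (by omega)) (by
      intro G hG
      have hbd : ∀ γ : Finset V → K, koszulD (1 : V → K) γ G =
          Finsupp.linearCombination K γ (boundary K (Finsupp.single G 1)) := fun γ => by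
        rw [linearCombination_boundary]; simp
      by_cases hcard : (G.card : ℤ) = i + 2
      · have h1 : l (boundary K (Finsupp.single G 1)) = 0 :=
          hl ⟨_, Finsupp.single_mem_supported K _ ⟨hG, by omega⟩, rfl⟩
        have h2 : l = Finsupp.linearCombination K fun F => l (Finsupp.single F 1) := by
          ext F; simp
        rw [h2, ← hbd] at h1
        rw [← h1, koszulD_apply, koszulD_apply]
        refine Finset.sum_congr rfl fun v hv => ?_
        have := Finset.card_erase_add_one hv
        rw [if_pos (by omega)]
      · rw [koszulD_apply]
        refine Finset.sum_eq_zero fun v hv => ?_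
        have := Finset.card_erase_add_one hv
        rw [if_neg (by omega), smul_zero, smul_zero])
  apply hlx
  have h2 : l = Finsupp.linearCombination K fun F => l (Finsupp.single F 1) := by
    ext F; simp
  have h3 : l x = Finsupp.linearCombination K (koszulD (1 : V → K) β) x := by
    rw [h2, Finsupp.linearCombination_apply, Finsupp.linearCombination_apply, Finsupp.sum,
      Finsupp.sum]
    refine Finset.sum_congr rfl fun F hF => ?_
    obtain ⟨hF1, hF2⟩ := hx.1 hF
    rw [hβ F hF1, if_pos hF2]
  rw [h3, ← linearCombination_boundary, LinearMap.mem_ker.1 hx.2, map_zero]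

end Duality

end SimplComplex

/-! ### The Stanley–Reisner ideal as a monomial ideal -/

namespace SimplComplex

section Ideal

variable {V : Type*} {K : Type*} [Field K]

/-- The exponent vector of the squarefree monomial with support `F`. -/
noncomputable def sqfreeExp (F : Finset V) : V →₀ ℕ := ∑ v ∈ F, Finsupp.single v 1

theorem sqfreeExp_apply [DecidableEq V] (F : Finset V) (v : V) :
    sqfreeExp F v = if v ∈ F then 1 else 0 := by
  simp [sqfreeExp, Finsupp.finsetSum_apply, Finsupp.single_apply]

theorem support_sqfreeExp [DecidableEq V] (F : Finset V) : (sqfreeExp F).support = F := by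
  ext v; simp [sqfreeExp_apply]

theorem sqfreeExp_le_iff [DecidableEq V] {F : Finset V} {a : V →₀ ℕ} :
    sqfreeExp F ≤ a ↔ F ⊆ a.support := by
  refine ⟨fun h v hv => ?_, fun h v => ?_⟩
  · have := h v
    rw [sqfreeExp_apply, if_pos hv] at this
    exact Finsupp.mem_support_iff.2 (by omega)
  · rw [sqfreeExp_apply]
    split_ifs with hv
    · exact Nat.one_le_iff_ne_zero.2 (Finsupp.mem_support_iff.1 (h hv))
    · exact Nat.zero_le _

variable (K) in
theorem prod_X_eq_monomial (F : Finset V) :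
    ∏ v ∈ F, (MvPolynomial.X v : MvPolynomial V K) = MvPolynomial.monomial (sqfreeExp F) 1 := by
  rw [sqfreeExp, MvPolynomial.monomial_sum_one]
  rfl

theorem mem_stanleyReisnerIdeal [DecidableEq V] {L : SimplComplex V} {p : MvPolynomial V K} :
    p ∈ L.stanleyReisnerIdeal K ↔ ∀ a : V →₀ ℕ, a.support ∈ L → p.coeff a = 0 := by
  have hset : {p : MvPolynomial V K | ∃ F : Finset V, F ∉ L ∧ p = ∏ v ∈ F, MvPolynomial.X v} =
      (fun s => MvPolynomial.monomial s 1) '' (sqfreeExp '' {F : Finset V | F ∉ L}) := by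
    ext p
    simp only [prod_X_eq_monomial, Set.mem_ofPred_eq, Set.mem_image, exists_exists_and_eq_and]
    exact exists_congr fun F => and_congr_right fun _ => eq_comm
  rw [stanleyReisnerIdeal, hset, MvPolynomial.mem_ideal_span_monomial_image]
  constructor
  · intro h a ha
    by_contra hp
    obtain ⟨_, ⟨F, hF, rfl⟩, hle⟩ := h a (MvPolynomial.mem_support_iff.2 hp)
    exact hF (L.down_closed _ ha _ (sqfreeExp_le_iff.1 hle))
  · intro h a ha
    refine ⟨_, ⟨a.support, fun hL => MvPolynomial.mem_support_iff.1 ha (h a hL), rfl⟩, ?_⟩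
    exact sqfreeExp_le_iff.2 subset_rfl

end Ideal

/-! ### Multigraded pieces of the Koszul complex -/

section Hochster

variable {V : Type*} [LinearOrder V] {K : Type*} [Field K]

theorem koszulD_mk (I : Ideal (MvPolynomial V K)) (z : V → MvPolynomial V K)
    (c : Finset V → MvPolynomial V K) :
    koszulD (fun v => Ideal.Quotient.mk I (z v)) (fun F => Ideal.Quotient.mk I (c F)) =
      fun F => Ideal.Quotient.mk I (koszulD z c F) :=
  koszulD_map (Ideal.Quotient.mk I).toAddMonoidHom (fun v m => by simp) c

/-- With weights zero on `N`, only vertices of `G` contribute on `N ∪ G`. The sign splits as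
`koszulSign N v * koszulSign G v`, and the first factor is absorbed by rescaling cochains by its
product over the set. -/
theorem koszulD_twist {N : Finset V} {z : V → K} (hz0 : ∀ v ∈ N, z v = 0)
    (hz1 : ∀ v ∉ N, z v = 1) {γ γ' : Finset V → K} {G : Finset V} (hG : Disjoint N G)
    (hγ : ∀ H ⊆ G, γ' H = (∏ u ∈ H, koszulSign N u) • γ (N ∪ H)) :
    koszulD z γ (N ∪ G) = (∏ u ∈ G, koszulSign N u) • koszulD (1 : V → K) γ' G := by
  rw [koszulD_apply, koszulD_apply, Finset.sum_union hG, Finset.sum_eq_zero, zero_add,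
    Finset.smul_sum]
  · refine Finset.sum_congr rfl fun v hv => ?_
    have hvN : v ∉ N := fun h => Finset.disjoint_left.1 hG h hv
    have hsq : (∏ u ∈ G.erase v, koszulSign N u) * (∏ u ∈ G.erase v, koszulSign N u) = 1 := by
      rw [← Finset.prod_mul_distrib]
      exact Finset.prod_eq_one fun u _ => koszulSign_mul_self N u
    rw [hz1 v hvN, Pi.one_apply, one_smul, one_smul, hγ _ (Finset.erase_subset v G),
      koszulSign_union hG, ← Finset.mul_prod_erase G _ hv, smul_smul, smul_smul,
      Finset.erase_union_distrib, Finset.erase_eq_of_notMem hvN]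
    congr 1
    linear_combination (-koszulSign N v * koszulSign G v) * hsq
  · intro v hv
    rw [hz0 v hv, zero_smul, smul_zero]

variable [Fintype V]

/-- The weights of the Koszul differential in the multidegree `d`, shifted so that the squarefree
degrees become `d ≤ 1`. -/
noncomputable def degreeWeight (K : Type*) [Field K] (d : V →₀ ℕ) (v : V) : K :=
  if d v = 0 then 0 else 1

/-- Giving `e_F` the degree of the complement of `F` makes the differential homogeneous: passing
from `F.erase v` to `F` loses one `v`, which `x_v` restores. The total degree here is `d = a +
sqfreeExp Fᶜ`. -/
theorem coeff_koszulD_X (c : Finset V → MvPolynomial V K) (F : Finset V) (a : V →₀ ℕ) :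
    (koszulD (MvPolynomial.X : V → MvPolynomial V K) c F).coeff a =
      koszulD (degreeWeight K (a + sqfreeExp Fᶜ))
        (fun G => (c G).coeff (a + sqfreeExp Fᶜ - sqfreeExp Gᶜ)) F := by
  rw [koszulD_apply, koszulD_apply, MvPolynomial.coeff_sum]
  refine Finset.sum_congr rfl fun v hv => ?_
  have hvF : v ∉ Fᶜ := by simpa using hv
  rw [MvPolynomial.coeff_smul, smul_eq_mul, MvPolynomial.coeff_X_mul', degreeWeight,
    Finsupp.add_apply, sqfreeExp_apply, if_neg hvF, add_zero]
  by_cases ha : a v = 0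
  · rw [if_neg (by simpa using ha), if_pos ha, zero_smul]
  · rw [if_pos (by simpa using ha), if_neg ha, one_smul]
    congr 2
    ext w
    simp only [Finsupp.tsub_apply, Finsupp.add_apply, sqfreeExp_apply, Finset.mem_compl,
      Finset.mem_erase, Finsupp.single_apply]
    rcases eq_or_ne v w with rfl | hne
    · simp [hv]
    · by_cases hw : w ∈ F <;> simp [hne, hne.symm, hw]

theorem LinksAcyclic.exists_primitive_degree {L : SimplComplex V} {e : ℕ}
    (h : L.LinksAcyclic K e) (d : V →₀ ℕ) {γ : Finset V → K} (hγ : ∀ F, e ≤ F.card → γ F = 0)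
    (hd : ∀ F : Finset V, (∀ v, d v = 0 → v ∈ F) → (d - sqfreeExp Fᶜ).support ∈ L →
      koszulD (degreeWeight K d) γ F = 0) :
    ∃ β : Finset V → K, ∀ F : Finset V, (∀ v, d v = 0 → v ∈ F) →
      (d - sqfreeExp Fᶜ).support ∈ L → koszulD (degreeWeight K d) β F = γ F := by
  by_cases hbig : ∃ v, 2 ≤ d v
  -- If `d v ≥ 2`, the exponent of `v` stays positive whether or not `v ∈ F`, so the piece is a cone
  -- with apex `v`.
  · obtain ⟨v, hv⟩ := hbig
    obtain ⟨β, hβ⟩ := CohAcyclic.of_cone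
      (𝓛 := {F | (∀ v, d v = 0 → v ∈ F) ∧ (d - sqfreeExp Fᶜ).support ∈ L})
      (z := degreeWeight K d) (v := v) (if_neg (by omega)) (by
        rintro F ⟨h1, h2⟩
        refine ⟨fun w hw => Finset.mem_insert_of_mem (h1 w hw), ?_⟩
        convert h2 using 1
        ext w
        simp only [Finsupp.mem_support_iff, Finsupp.tsub_apply, sqfreeExp_apply,
          Finset.mem_compl, Finset.mem_insert]
        rcases eq_or_ne w v with rfl | hne
        · split_ifs <;> omega
        · simp [hne]) (fun F hF => hd F hF.1 hF.2)
    exact ⟨β, fun F h1 h2 => hβ F ⟨h1, h2⟩⟩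
  · push Not at hbig
    let N : Finset V := Finset.univ.filter fun v => d v = 0
    have hN : ∀ v, v ∈ N ↔ d v = 0 := fun v => by simp [N]
    have hsupp : ∀ G : Finset V, Disjoint N G → (d - sqfreeExp (N ∪ G)ᶜ).support = G := by
      intro G hG
      ext v
      have h2 := hbig v
      have h3 : v ∈ G → d v ≠ 0 := fun hv h0 => Finset.disjoint_left.1 hG ((hN v).2 h0) hv
      simp only [Finsupp.mem_support_iff, Finsupp.tsub_apply, sqfreeExp_apply, Finset.mem_compl,
        Finset.mem_union, hN]
      by_cases hv : v ∈ G
      · simp [hv, h3 hv]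
      · by_cases h0 : d v = 0
        · simp [hv, h0]
        · simp only [h0, hv, or_self, not_false_eq_true, if_true, iff_false, not_not]
          omega
    have hz0 : ∀ v ∈ N, degreeWeight K d v = 0 := fun v hv => if_pos ((hN v).1 hv)
    have hz1 : ∀ v ∉ N, degreeWeight K d v = 1 := fun v hv => if_neg fun h => hv ((hN v).2 h)
    have hsq : ∀ H : Finset V, (∏ u ∈ H, koszulSign N u) * (∏ u ∈ H, koszulSign N u) = 1 := by
      intro H
      rw [← Finset.prod_mul_distrib]
      exact Finset.prod_eq_one fun u _ => koszulSign_mul_self N u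
    -- The indices are now the sets `N ∪ G` with `G` a face avoiding `N`. The loss of `#N` degrees
    -- under restriction is exactly the shift from `#G` to `#(N ∪ G)`.
    have hacyc := h.restrict N ∅ (Finset.disjoint_empty_right N)
    obtain ⟨β, hβ⟩ := hacyc (fun G => if Disjoint N G then
        (∏ u ∈ G, koszulSign N u) • γ (N ∪ G) else 0)
      (by
        intro F hF
        split_ifs with hdis
        · rw [hγ, smul_zero]
          rw [Finset.card_union_of_disjoint hdis]
          simp only [Finset.card_empty] at hF
          omega
        · rfl)
      (by
        rintro G ⟨hGN, -, hGL⟩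
        rw [Finset.union_empty] at hGL
        have := koszulD_twist hz0 hz1 hGN.symm (γ := γ) (γ' := fun G => if Disjoint N G then
          (∏ u ∈ G, koszulSign N u) • γ (N ∪ G) else 0)
          (fun H hH => if_pos (Finset.disjoint_of_subset_right hH hGN.symm))
        rw [hd _ (fun v hv => Finset.mem_union_left _ ((hN v).2 hv))
          (by rwa [hsupp G hGN.symm])] at this
        have h2 := congrArg (fun x => (∏ u ∈ G, koszulSign N u) • x) this
        rw [smul_zero, smul_smul, hsq, one_smul] at h2
        exact h2.symm)
    refine ⟨fun F => (∏ u ∈ F \ N, koszulSign N u) • β (F \ N), fun F h1 h2 => ?_⟩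
    obtain ⟨G, hG, rfl⟩ : ∃ G, Disjoint N G ∧ N ∪ G = F :=
      ⟨F \ N, Finset.disjoint_sdiff, Finset.union_sdiff_of_subset fun v hv => h1 v ((hN v).1 hv)⟩
    rw [hsupp G hG] at h2
    rw [koszulD_twist hz0 hz1 hG (γ' := β), hβ G ⟨hG.symm, Finset.disjoint_empty_right _, by
      rwa [Finset.union_empty]⟩, if_pos hG, smul_smul, hsq, one_smul]
    intro H hH
    have hNH : (N ∪ H) \ N = H :=
      Finset.union_sdiff_cancel_left (Finset.disjoint_of_subset_right hH hG)
    rw [hNH, smul_smul, hsq, one_smul]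

/-- If the links of `L` are acyclic, then the Koszul cohomology of the variables on the
Stanley–Reisner ring vanishes in low degrees. -/
theorem LinksAcyclic.koszulDepthGE {L : SimplComplex V} {e : ℕ} (h : L.LinksAcyclic K e) :
    KoszulDepthGE (L.StanleyReisnerRing K)
      (fun v => Ideal.Quotient.mk (L.stanleyReisnerIdeal K) (MvPolynomial.X v)) e := by
  classical
  intro c hc hd
  have hlift : ∀ F, ∃ p : MvPolynomial V K, Ideal.Quotient.mk (L.stanleyReisnerIdeal K) p = c F ∧
      (e ≤ F.card → p = 0) := by
    intro F
    by_cases hF : e ≤ F.card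
    · exact ⟨0, by rw [hc F hF, map_zero], fun _ => rfl⟩
    · obtain ⟨p, hp⟩ := Ideal.Quotient.mk_surjective (c F)
      exact ⟨p, hp, fun h => absurd h hF⟩
  choose c' hc' hsupp using hlift
  obtain rfl : (fun F => Ideal.Quotient.mk _ (c' F)) = c := funext hc'
  rw [koszulD_mk] at hd
  have hadd : ∀ (d : V →₀ ℕ) (F : Finset V), (∀ v, d v = 0 → v ∈ F) →
      d - sqfreeExp Fᶜ + sqfreeExp Fᶜ = d := by
    intro d F hdF
    refine tsub_add_cancel_of_le (sqfreeExp_le_iff.2 fun v hv => ?_)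
    rw [Finsupp.mem_support_iff]
    exact fun h0 => Finset.mem_compl.1 hv (hdF v h0)
  have hexists : ∀ d : V →₀ ℕ, ∃ β : Finset V → K, ∀ F : Finset V, (∀ v, d v = 0 → v ∈ F) →
      (d - sqfreeExp Fᶜ).support ∈ L →
        koszulD (degreeWeight K d) β F = (c' F).coeff (d - sqfreeExp Fᶜ) := by
    intro d
    refine h.exists_primitive_degree d (γ := fun F => (c' F).coeff (d - sqfreeExp Fᶜ))
      (fun F hF => by rw [hsupp F hF, MvPolynomial.coeff_zero]) fun F hdF hL => ?_
    have h1 := coeff_koszulD_X c' F (d - sqfreeExp Fᶜ)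
    rw [hadd d F hdF] at h1
    rw [← h1]
    exact mem_stanleyReisnerIdeal.1 (Ideal.Quotient.eq_zero_iff_mem.1 (congrFun hd F)) _ hL
  choose β hβ using hexists
  -- The multidegrees that occur in `c'`: finitely many, so the primitives found degree by degree
  -- assemble to polynomials.
  let D : Finset (V →₀ ℕ) :=
    Finset.univ.biUnion fun F => (c' F).support.image (· + sqfreeExp Fᶜ)
  let b : Finset V → MvPolynomial V K := fun F =>
    ∑ d ∈ D.filter fun d => ∀ v, d v = 0 → v ∈ F,
      MvPolynomial.monomial (d - sqfreeExp Fᶜ) (β d F)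
  have hcond : ∀ (a : V →₀ ℕ) (F : Finset V) (v : V), (a + sqfreeExp Fᶜ) v = 0 → v ∈ F := by
    intro a F v hv
    by_contra hvF
    rw [Finsupp.add_apply, sqfreeExp_apply, if_pos (Finset.mem_compl.2 hvF)] at hv
    omega
  have hb : ∀ F a, (b F).coeff a =
      if a + sqfreeExp Fᶜ ∈ D then β (a + sqfreeExp Fᶜ) F else 0 := by
    intro F a
    simp only [b, MvPolynomial.coeff_sum, MvPolynomial.coeff_monomial]
    rw [Finset.sum_congr rfl (g := fun d => if d = a + sqfreeExp Fᶜ then β d F else 0)]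
    · rw [Finset.sum_ite_eq']
      simp only [Finset.mem_filter]
      exact if_congr (and_iff_left (hcond a F)) rfl rfl
    · intro d hdD
      rw [Finset.mem_filter] at hdD
      refine if_congr ⟨fun h => ?_, fun h => ?_⟩ rfl rfl
      · rw [← h, hadd d F hdD.2]
      · rw [h, add_tsub_cancel_right]
  refine ⟨fun F => Ideal.Quotient.mk _ (b F), ?_⟩
  rw [koszulD_mk]
  ext F
  rw [Ideal.Quotient.eq, mem_stanleyReisnerIdeal]
  intro a ha
  rw [MvPolynomial.coeff_sub, coeff_koszulD_X, sub_eq_zero]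
  have hcongr : koszulD (degreeWeight K (a + sqfreeExp Fᶜ))
      (fun G => (b G).coeff (a + sqfreeExp Fᶜ - sqfreeExp Gᶜ)) F =
      koszulD (degreeWeight K (a + sqfreeExp Fᶜ))
        (fun G => if a + sqfreeExp Fᶜ ∈ D then β (a + sqfreeExp Fᶜ) G else 0) F := by
    rw [koszulD_apply, koszulD_apply]
    refine Finset.sum_congr rfl fun v hv => ?_
    by_cases h0 : (a + sqfreeExp Fᶜ) v = 0
    · rw [degreeWeight, if_pos h0, zero_smul, zero_smul]
    · rw [hb, hadd]
      intro w hw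
      rw [Finset.mem_erase]
      exact ⟨fun h => h0 (h ▸ hw), hcond a F w hw⟩
  rw [hcongr]
  by_cases hD : a + sqfreeExp Fᶜ ∈ D
  · simp only [if_pos hD]
    rw [hβ _ F (hcond a F) (by rwa [add_tsub_cancel_right]), add_tsub_cancel_right]
  · simp only [if_neg hD]
    have hzero : (c' F).coeff a = 0 := by
      by_contra hne
      exact hD (Finset.mem_biUnion.2 ⟨F, Finset.mem_univ F,
        Finset.mem_image.2 ⟨a, MvPolynomial.mem_support_iff.2 hne, rfl⟩⟩)
    rw [hzero, koszulD_apply]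
    exact Finset.sum_eq_zero fun v _ => by rw [smul_zero, smul_zero]

end Hochster

end SimplComplex

/-! ### Stanley–Reisner rings of vertex links -/

namespace SimplComplex

section StanleyReisner

variable {V : Type*} {K : Type*} [Field K]

variable (K) in
/-- The image of the variable of `v` in the Stanley–Reisner ring. -/
noncomputable abbrev srX (L : SimplComplex V) (v : V) : L.StanleyReisnerRing K :=
  Ideal.Quotient.mk (L.stanleyReisnerIdeal K) (MvPolynomial.X v)

theorem prod_srX_eq_zero {L : SimplComplex V} {F : Finset V} (hF : F ∉ L) :
    ∏ v ∈ F, L.srX K v = 0 := by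
  rw [← map_prod, Ideal.Quotient.eq_zero_iff_mem]
  exact Ideal.subset_span ⟨F, hF, rfl⟩

theorem srX_eq_zero {L : SimplComplex V} {v : V} (hv : {v} ∉ L) : L.srX K v = 0 := by
  simpa using prod_srX_eq_zero (K := K) hv

/-- The universal property of the Stanley–Reisner ring. -/
noncomputable def srLift (L : SimplComplex V) {C : Type*} [CommRing C] [Algebra K C] (g : V → C)
    (hg : ∀ F : Finset V, F ∉ L → ∏ v ∈ F, g v = 0) : L.StanleyReisnerRing K →ₐ[K] C :=
  Ideal.Quotient.liftₐ _ (MvPolynomial.aeval g) (by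
    have : L.stanleyReisnerIdeal K ≤ RingHom.ker (MvPolynomial.aeval (R := K) g) := by
      rw [stanleyReisnerIdeal, Ideal.span_le]
      rintro _ ⟨F, hF, rfl⟩
      rw [SetLike.mem_coe, RingHom.mem_ker, map_prod]
      simpa using hg F hF
    exact fun a ha => this ha)

theorem srLift_srX (L : SimplComplex V) {C : Type*} [CommRing C] [Algebra K C] (g : V → C)
    (hg : ∀ F : Finset V, F ∉ L → ∏ v ∈ F, g v = 0) (v : V) :
    L.srLift (K := K) g hg (L.srX K v) = g v := by
  change MvPolynomial.aeval g (MvPolynomial.X v) = g v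
  rw [MvPolynomial.aeval_X]

theorem sr_algHom_ext {L : SimplComplex V} {C : Type*} [CommRing C] [Algebra K C]
    {f g : L.StanleyReisnerRing K →ₐ[K] C} (h : ∀ v, f (L.srX K v) = g (L.srX K v)) : f = g := by
  apply Ideal.Quotient.algHom_ext
  apply MvPolynomial.algHom_ext
  exact h

end StanleyReisner

section LinkPolynomial

open Polynomial

variable {V : Type*} [LinearOrder V] {K : Type*} [Field K]

/-- The restriction `K[L] → K[lk v][X]` to the star of a vertex, with `x_v ↦ X`. -/
noncomputable def toLinkPolynomial (L : SimplComplex V) (v : V) (hv : {v} ∈ L) :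
    L.StanleyReisnerRing K →ₐ[K] ((L.link {v} hv).StanleyReisnerRing K)[X] :=
  L.srLift (fun w => if w = v then X else C ((L.link {v} hv).srX K w)) (by
    intro F hF
    have key : ∀ G : Finset V, v ∉ G → insert v G ∉ L → ∏ w ∈ G, (if w = v then X else
        C ((L.link {v} hv).srX K w) : ((L.link {v} hv).StanleyReisnerRing K)[X]) = 0 := by
      intro G hvG hG
      rw [Finset.prod_congr rfl (g := fun w => C ((L.link {v} hv).srX K w)), ← map_prod,
        prod_srX_eq_zero, map_zero]
      · intro h
        rw [mem_link, Finset.union_comm, Finset.singleton_union] at h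
        exact hG h.1
      · exact fun w hw => if_neg fun h : w = v => hvG (h ▸ hw)
    by_cases hvF : v ∈ F
    · rw [← Finset.mul_prod_erase F _ hvF, key _ (Finset.notMem_erase v F)
        (by rwa [Finset.insert_erase hvF]), mul_zero]
    · exact key F hvF fun h => hF (L.down_closed _ h _ (Finset.subset_insert v F)))

theorem toLinkPolynomial_srX_self (L : SimplComplex V) (v : V) (hv : {v} ∈ L) :
    L.toLinkPolynomial (K := K) v hv (L.srX K v) = X := by
  rw [toLinkPolynomial, srLift_srX, if_pos rfl]

theorem toLinkPolynomial_srX_of_ne (L : SimplComplex V) {v w : V} (hv : {v} ∈ L) (hw : w ≠ v) :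
    L.toLinkPolynomial (K := K) v hv (L.srX K w) = C ((L.link {v} hv).srX K w) := by
  rw [toLinkPolynomial, srLift_srX, if_neg hw]

theorem srX_link_self (L : SimplComplex V) {v : V} (hv : {v} ∈ L) :
    (L.link {v} hv).srX K v = 0 :=
  srX_eq_zero fun h => by simpa using ((mem_link hv).1 h).2

theorem toLinkPolynomial_surjective (L : SimplComplex V) (v : V) (hv : {v} ∈ L) :
    Function.Surjective (L.toLinkPolynomial (K := K) v hv) := by
  rw [← AlgHom.range_eq_top, eq_top_iff]
  rintro p -
  have hC : ∀ b : (L.link {v} hv).StanleyReisnerRing K,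
      C b ∈ (L.toLinkPolynomial (K := K) v hv).range := by
    intro b
    obtain ⟨q, rfl⟩ := Ideal.Quotient.mk_surjective b
    induction q using MvPolynomial.induction_on with
    | C a => exact Subalgebra.algebraMap_mem _ a
    | add p q hp hq => rw [map_add, map_add]; exact add_mem hp hq
    | mul_X p w hp =>
      rw [map_mul, map_mul]
      refine mul_mem hp ?_
      by_cases hw : w = v
      · subst hw
        rw [show Ideal.Quotient.mk _ (MvPolynomial.X w) = 0 from srX_link_self (K := K) L hv,
          map_zero]
        exact zero_mem _
      · exact ⟨L.srX K w, toLinkPolynomial_srX_of_ne L hv hw⟩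
  induction p using Polynomial.induction_on' with
  | add p q hp hq => exact add_mem hp hq
  | monomial n b =>
    rw [← C_mul_X_pow_eq_monomial]
    have hX : X ∈ (L.toLinkPolynomial (K := K) v hv).range := ⟨_, toLinkPolynomial_srX_self L v hv⟩
    exact mul_mem (hC b) (pow_mem hX n)

theorem exists_algHom_eq_zero_iff_mul_eq_zero.{u} (K : Type*) {R : Type u} [Field K] [CommRing R]
    [Algebra K R] (x : R) : ∃ (Q : Type u) (_ : CommRing Q) (_ : Algebra K Q) (q : R →ₐ[K] Q),
      ∀ p, q p = 0 ↔ x * p = 0 := by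
  refine ⟨R ⧸ (⊥ : Ideal R).colon {x}, inferInstance, inferInstance,
    Ideal.Quotient.mkₐ K ((⊥ : Ideal R).colon {x}), fun p => ?_⟩
  rw [Ideal.Quotient.mkₐ_eq_mk, Ideal.Quotient.eq_zero_iff_mem, Submodule.mem_colon_singleton,
    Submodule.mem_bot, smul_eq_mul, mul_comm]

/-- Any `q` that kills the annihilator of `x_v` factors through `K[lk v][X]`: a nonface of the link
that avoids `v` gives a monomial killed by `x_v`. Taking for `q` the quotient by that annihilator
shows that the kernel of the restriction to the star annihilates `x_v`. -/
theorem map_eq_zero_of_toLinkPolynomial (L : SimplComplex V) (v : V) (hv : {v} ∈ L) {Q : Type*}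
    [CommRing Q] [Algebra K Q] (q : L.StanleyReisnerRing K →ₐ[K] Q)
    (hq : ∀ r, L.srX K v * r = 0 → q r = 0) {p : L.StanleyReisnerRing K}
    (hp : L.toLinkPolynomial v hv p = 0) : q p = 0 := by
  have hg : ∀ F : Finset V, F ∉ L.link {v} hv →
      ∏ w ∈ F, (if w = v then 0 else q (L.srX K w)) = 0 := by
    intro F hF
    by_cases hvF : v ∈ F
    · exact Finset.prod_eq_zero hvF (if_pos rfl)
    · rw [Finset.prod_congr rfl (g := fun w => q (L.srX K w)), ← map_prod]
      · refine hq _ ?_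
        rw [← Finset.prod_insert (f := L.srX K) hvF]
        refine prod_srX_eq_zero fun h => hF ?_
        rw [mem_link, Finset.union_comm, Finset.singleton_union]
        exact ⟨h, by simpa using hvF⟩
      · exact fun w hw => if_neg fun h : w = v => hvF (h ▸ hw)
  let ρ : (L.link {v} hv).StanleyReisnerRing K →ₐ[K] Q := (L.link {v} hv).srLift _ hg
  let ψ : ((L.link {v} hv).StanleyReisnerRing K)[X] →ₐ[K] Q :=
    Polynomial.eval₂AlgHom ρ (q (L.srX K v)) fun _ => Commute.all _ _
  have hcomp : ψ.comp (L.toLinkPolynomial v hv) = q := by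
    refine sr_algHom_ext fun w => ?_
    rw [AlgHom.comp_apply]
    by_cases hw : w = v
    · subst hw
      rw [toLinkPolynomial_srX_self]
      exact Polynomial.eval₂_X _ _
    · rw [toLinkPolynomial_srX_of_ne L hv hw]
      refine (Polynomial.eval₂_C _ _).trans ?_
      exact (srLift_srX _ _ hg w).trans (if_neg hw)
  rw [← hcomp, AlgHom.comp_apply, hp, map_zero]

theorem srX_mul_eq_zero_of_toLinkPolynomial (L : SimplComplex V) (v : V) (hv : {v} ∈ L)
    {p : L.StanleyReisnerRing K} (hp : L.toLinkPolynomial v hv p = 0) : L.srX K v * p = 0 := by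
  obtain ⟨Q, _, _, q, hq⟩ := exists_algHom_eq_zero_iff_mul_eq_zero K (L.srX K v)
  exact (hq p).1 (map_eq_zero_of_toLinkPolynomial L v hv q (fun r hr => (hq r).2 hr) hp)

end LinkPolynomial

end SimplComplex

/-! ### Koszul depth of polynomials in the variables -/

section PolynomialKoszul

open Polynomial

variable {V : Type*} [LinearOrder V]

theorem KoszulDepthGE.of_isUnit {A M : Type*} [CommRing A] [AddCommGroup M] [Module A M]
    {z : V → A} {v : V} (hv : IsUnit (z v)) (e : ℕ) : KoszulDepthGE M z e := by
  intro c _ hd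
  refine ⟨(↑hv.unit⁻¹ : A) • koszulContract v c, ?_⟩
  have := koszulD_contract z v c
  rw [hd, map_zero, add_zero] at this
  rw [koszulD_smul, this, smul_smul, hv.val_inv_mul, one_smul]

/-- A monic polynomial in a new variable raises the Koszul depth by one. -/
theorem KoszulDepthGE.polynomial [Fintype V] {B : Type*} [CommRing B] {v : V} {g : B[X]}
    (hg : g.Monic) {ζ : V → B} (hζ : ζ v = 0) {e : ℕ} (h : KoszulDepthGE B ζ e) :
    KoszulDepthGE B[X] (fun w => if w = v then g else C (ζ w)) (e + 1) := by
  -- A monic `g` is regular and `B[X]/(g)` is free of finite rank over `B`. There the entry `g` at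
  -- `v` acts as `0 = ζ v`, so depth over `B` carries over to the quotient.
  refine KoszulDepthGE.of_quotSMulTop (y := g) (Ideal.subset_span ⟨v, if_pos rfl⟩)
    (fun p q hpq => hg.isRegular.left hpq) ?_
  let E : AdjoinRoot g ≃ₗ[B] (Fin (AdjoinRoot.powerBasis' hg).dim → B) :=
    (AdjoinRoot.powerBasis' hg).basis.equivFun
  let Q : QuotSMulTop g B[X] ≃ₗ[B[X]] (B[X] ⧸ Ideal.span {g}) :=
    Submodule.quotEquivOfEq _ _ (by
      ext p
      simp [Submodule.mem_smul_pointwise_iff_exists, Ideal.mem_span_singleton', mul_comm])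
  refine KoszulDepthGE.of_addEquiv (Q.toAddEquiv.trans E.toAddEquiv) (z' := ζ) ?_ h.pi
  intro w m
  obtain ⟨p, rfl⟩ := Submodule.Quotient.mk_surjective _ m
  change E (AdjoinRoot.mk g ((if w = v then g else C (ζ w)) * p)) = ζ w • E (AdjoinRoot.mk g p)
  rw [← map_smul, map_mul]
  congr 1
  split_ifs with hw
  · rw [AdjoinRoot.mk_self, zero_mul, hw, hζ, zero_smul]
  · rw [Algebra.smul_def]; rfl

end PolynomialKoszul

namespace SimplComplex

open Polynomial

variable {V : Type*} [LinearOrder V] [Fintype V] {K : Type*} [Field K]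

/-- Induction on the number of `v` with `f v ≠ X`. For such `v`, the constant term of `f v` is a
unit, so a cocycle `c` is a coboundary once `f_v(x_v) c` and `x_v c` are. The first holds by
contraction. The second can be checked in `K[lk v][X]`, where the link loses one degree of depth and
the monic `f v` regains it. -/
theorem LinksAcyclic.koszulDepthGE_aeval {L : SimplComplex V} {e : ℕ} (h : L.LinksAcyclic K e)
    (f : V → K[X]) (hf : ∀ v, f v = X ∨ ((f v).Monic ∧ (f v).coeff 0 ≠ 0)) :
    KoszulDepthGE (L.StanleyReisnerRing K) (fun v => aeval (L.srX K v) (f v)) e := by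
  classical
  induction hn : (Finset.univ.filter fun v => f v ≠ X).card generalizing L e f with
  | zero =>
    have hX : ∀ v, f v = X := by
      intro v
      by_contra hv
      have := Finset.card_pos.2 ⟨v, (Finset.mem_filter (p := fun v => f v ≠ X)).2
        ⟨Finset.mem_univ v, hv⟩⟩
      omega
    simpa only [hX, aeval_X] using h.koszulDepthGE
  | succ n ih =>
    obtain ⟨v, hv⟩ := Finset.card_pos.1 (by rw [hn]; exact n.succ_pos)
    have hvX : f v ≠ X := (Finset.mem_filter.1 hv).2
    obtain ⟨hmonic, hcoeff⟩ := (hf v).resolve_left hvX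
    have hdecomp : ∀ x : L.StanleyReisnerRing K, aeval x (f v) =
        aeval x (divX (f v)) * x + algebraMap K _ ((f v).coeff 0) := by
      intro x
      conv_lhs => rw [← divX_mul_X_add (f v)]
      rw [map_add, map_mul, aeval_X, aeval_C]
    have hunit : IsUnit (algebraMap K (L.StanleyReisnerRing K) ((f v).coeff 0)) :=
      (isUnit_iff_ne_zero.2 hcoeff).map _
    by_cases hvL : {v} ∈ L
    swap
    · refine KoszulDepthGE.of_isUnit (v := v) ?_ e
      rwa [hdecomp, srX_eq_zero hvL, mul_zero, zero_add]
    rcases e with _ | e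
    · exact koszulDepthGE_zero _
    -- In the link `x_v = 0`, so resetting `f v` to `X` makes the entry at `v` zero, as
    -- `KoszulDepthGE.polynomial` requires, and lowers the induction count.
    have hih := ih (h.link_singleton hvL) (Function.update f v X) (by
        intro w
        by_cases hw : w = v
        · subst hw; left; exact Function.update_self _ _ _
        · rw [Function.update_of_ne hw]; exact hf w) (by
        have : (Finset.univ.filter fun w => Function.update f v X w ≠ X) =
            (Finset.univ.filter fun w => f w ≠ X).erase v := by
          ext w
          by_cases hw : w = v
          · subst hw; simp
          · simp [hw]
        rw [this, Finset.card_erase_of_mem hv, hn, Nat.add_sub_cancel])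
    have hpoly := hih.polynomial (hmonic.map (algebraMap K ((L.link {v} hvL).StanleyReisnerRing K)))
      (v := v) (by rw [Function.update_self, aeval_X, srX_link_self])
    rw [Nat.add_sub_cancel] at hpoly
    have hz : ∀ w, L.toLinkPolynomial v hvL (aeval (L.srX K w) (f w)) =
        if w = v then (f v).map (algebraMap K ((L.link {v} hvL).StanleyReisnerRing K))
        else C (aeval ((L.link {v} hvL).srX K w) (Function.update f v X w)) := by
      intro w
      rw [← aeval_algHom_apply]
      split_ifs with hw
      · subst hw
        rw [toLinkPolynomial_srX_self, aeval_X_left_eq_map]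
      · rw [toLinkPolynomial_srX_of_ne L hvL hw, Function.update_of_ne hw]
        exact aeval_algHom_apply (CAlgHom (R := K)
          (A := (L.link {v} hvL).StanleyReisnerRing K)) _ _
    have hmap := koszulD_map (z := fun w => aeval (L.srX K w) (f w)) 
      (z' := fun w => if w = v then (f v).map (algebraMap K ((L.link {v} hvL).StanleyReisnerRing K))
        else C (aeval ((L.link {v} hvL).srX K w) (Function.update f v X w)))
      (L.toLinkPolynomial v hvL).toRingHom.toAddMonoidHom
      (fun w m => (map_mul (L.toLinkPolynomial v hvL) _ m).trans
        (congrArg (· * L.toLinkPolynomial v hvL m) (hz w)))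
    intro c hc hd
    obtain ⟨b, hb⟩ := hpoly (fun F => L.toLinkPolynomial v hvL (c F))
      (fun F hF => by rw [hc F hF, map_zero]) (by
        refine (hmap c).trans ?_
        rw [hd]
        ext F : 1
        exact map_zero _)
    choose b' hb' using fun F => toLinkPolynomial_surjective (K := K) L v hvL (b F)
    obtain rfl : (fun F => L.toLinkPolynomial v hvL (b' F)) = b := funext hb'
    -- The difference `c - d b'` dies in `K[lk v][X]`, hence is killed by `x_v`.
    have hxc : L.srX K v • c = koszulD (fun w => aeval (L.srX K w) (f w)) (L.srX K v • b') := by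
      rw [koszulD_smul]
      ext F : 1
      have h1 := congrFun ((hmap b').symm.trans hb) F
      have h2 := srX_mul_eq_zero_of_toLinkPolynomial L v hvL
        (p := c F - koszulD (fun w => aeval (L.srX K w) (f w)) b' F)
        (by rw [map_sub, sub_eq_zero]; exact h1.symm)
      rw [mul_sub, sub_eq_zero] at h2
      exact h2
    have hhom := koszulD_contract (fun w => aeval (L.srX K w) (f w)) v c
    rw [hd, map_zero, add_zero, hdecomp, add_smul, mul_smul, hxc, ← koszulD_smul] at hhom
    refine ⟨(↑hunit.unit⁻¹ : L.StanleyReisnerRing K) • (koszulContract v c -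
      aeval (L.srX K v) (divX (f v)) • L.srX K v • b'), ?_⟩
    rw [koszulD_smul, map_sub, hhom, add_sub_cancel_left, smul_smul, hunit.val_inv_mul, one_smul]

end SimplComplex

/-! ### Krull dimension and height -/

namespace SimplComplex

section Dimension

variable {V : Type*} {K : Type*} [Field K]

theorem ringKrullDim_stanleyReisnerRing_le [Finite V] {L : SimplComplex V} {e : ℕ}
    (hL : ∀ F ∈ L, F.card ≤ e) : ringKrullDim (L.StanleyReisnerRing K) ≤ e := by
  classical
  have := Fintype.ofFinite V
  refine iSup_le fun l => ?_
  -- The variables outside the smallest prime of the chain form a face `F`. Modulo that prime,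
  -- `K[L]` is a quotient of the polynomial ring on `F`, so the chain pulls back to a strict chain
  -- there.
  let F : Finset V := Finset.univ.filter fun v => L.srX K v ∉ l.head.asIdeal
  have hF : F ∈ L := by
    by_contra h
    have h0 : ∏ v ∈ F, L.srX K v ∈ l.head.asIdeal := by
      rw [prod_srX_eq_zero h]; exact zero_mem _
    obtain ⟨v, hv, hmem⟩ := (l.head.isPrime.prod_mem_iff).1 h0
    exact (Finset.mem_filter.1 hv).2 hmem
  let f : MvPolynomial F K →ₐ[K] L.StanleyReisnerRing K := MvPolynomial.aeval fun v => L.srX K v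
  have hsurj : ∀ r, ∃ s, r - f s ∈ l.head.asIdeal := by
    intro r
    obtain ⟨p, rfl⟩ := Ideal.Quotient.mk_surjective r
    induction p using MvPolynomial.induction_on with
    | C a =>
      refine ⟨MvPolynomial.C a, ?_⟩
      rw [show f (MvPolynomial.C a) = Ideal.Quotient.mk _ (MvPolynomial.C a) from
        f.commutes a, sub_self]
      exact zero_mem _
    | add p q hp hq =>
      obtain ⟨s, hs⟩ := hp
      obtain ⟨t, ht⟩ := hq
      refine ⟨s + t, ?_⟩
      rw [map_add, map_add, add_sub_add_comm]
      exact add_mem hs ht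
    | mul_X p v hp =>
      obtain ⟨s, hs⟩ := hp
      by_cases hv : v ∈ F
      · refine ⟨s * MvPolynomial.X ⟨v, hv⟩, ?_⟩
        rw [map_mul, map_mul, show f (MvPolynomial.X ⟨v, hv⟩) = L.srX K v from
          MvPolynomial.aeval_X _ _, ← sub_mul]
        exact Ideal.mul_mem_right _ _ hs
      · refine ⟨0, ?_⟩
        rw [map_zero, sub_zero, map_mul]
        refine Ideal.mul_mem_left _ _ ?_
        by_contra h
        exact hv (Finset.mem_filter.2 ⟨Finset.mem_univ v, h⟩)
  let l' : LTSeries (PrimeSpectrum (MvPolynomial F K)) :=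
    { length := l.length
      toFun := fun i => PrimeSpectrum.comap f.toRingHom (l i)
      step := by
        intro i
        have hlt : l i.castSucc < l i.succ := l.step i
        refine lt_of_le_of_ne (Ideal.comap_mono hlt.le) fun heq => hlt.not_ge fun r hr => ?_
        obtain ⟨s, hs⟩ := hsurj r
        have h1 : r - f s ∈ (l i.castSucc).asIdeal := l.head_le _ hs
        have h2 : f s ∈ (l i.succ).asIdeal := by
          rw [← sub_sub_cancel r (f s)]
          exact sub_mem hr (hlt.le h1)
        have h3 : s ∈ (PrimeSpectrum.comap f.toRingHom (l i.castSucc)).asIdeal :=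
          (congrArg (s ∈ ·) heq).mpr h2
        rw [← sub_add_cancel r (f s)]
        exact add_mem h1 h3 }
  have h1 : (l'.length : WithBot ℕ∞) ≤ ringKrullDim (MvPolynomial F K) :=
    Order.LTSeries.length_le_krullDim l'
  rw [MvPolynomial.ringKrullDim_of_isNoetherianRing, ringKrullDim_eq_zero_of_field, zero_add,
    Nat.card_eq_fintype_card, Fintype.card_coe] at h1
  refine h1.trans ?_
  exact_mod_cast hL F hF

variable (K) in
/-- The map `K[L] → K[x_v : v ∈ V]` that kills the variables outside the face `F`. -/
noncomputable def faceMap [DecidableEq V] (L : SimplComplex V) {F : Finset V} (hF : F ∈ L) :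
    L.StanleyReisnerRing K →ₐ[K] MvPolynomial V K :=
  L.srLift (fun v => if v ∈ F then MvPolynomial.X v else 0) (by
    intro G hG
    obtain ⟨v, hvG, hvF⟩ : ∃ v ∈ G, v ∉ F := by
      by_contra! h
      exact hG (L.down_closed _ hF _ h)
    exact Finset.prod_eq_zero hvG (if_neg hvF))

theorem faceMap_srX [DecidableEq V] (L : SimplComplex V) {F : Finset V} (hF : F ∈ L) (v : V) :
    L.faceMap K hF (L.srX K v) = if v ∈ F then MvPolynomial.X v else 0 :=
  srLift_srX _ _ _ v

theorem ker_faceMap_lt [DecidableEq V] (L : SimplComplex V) {F G : Finset V} (hF : F ∈ L)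
    (hG : G ∈ L) (h : F ⊂ G) : RingHom.ker (L.faceMap K hG) < RingHom.ker (L.faceMap K hF) := by
  have hcomp : (MvPolynomial.aeval (R := K) (fun v => if v ∈ F then (MvPolynomial.X v :
      MvPolynomial V K) else 0)).comp (L.faceMap K hG) = L.faceMap K hF := by
    refine sr_algHom_ext fun v => ?_
    rw [AlgHom.comp_apply, faceMap_srX, faceMap_srX]
    by_cases hv : v ∈ G
    · rw [if_pos hv, MvPolynomial.aeval_X]
    · rw [if_neg hv, map_zero, if_neg fun hvF => hv (h.1 hvF)]
  obtain ⟨v, hvG, hvF⟩ := Finset.exists_of_ssubset h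
  refine lt_of_le_of_ne (fun p hp => ?_) fun heq => ?_
  · rw [RingHom.mem_ker] at hp ⊢
    rw [← hcomp, AlgHom.comp_apply, hp, map_zero]
  · have h1 : L.srX K v ∈ RingHom.ker (L.faceMap K hF) := by
      rw [RingHom.mem_ker, faceMap_srX, if_neg hvF]
    rw [← heq, RingHom.mem_ker, faceMap_srX, if_pos hvG] at h1
    exact MvPolynomial.X_ne_zero v h1

/-- Removing the vertices of `G` from `F` one by one gives a strict chain of face primes. -/
theorem card_le_height_ker_faceMap [DecidableEq V] (L : SimplComplex V) {F : Finset V} (hF : F ∈ L)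
    (G : Finset V) : ∀ (hG : F \ G ∈ L), G ⊆ F →
      (G.card : ℕ∞) ≤ (RingHom.ker (L.faceMap K hG)).height := by
  induction G using Finset.induction_on with
  | empty => intro _ _; simp
  | insert v G hv ih =>
    intro hG hsub
    have hG' : F \ G ∈ L := L.down_closed _ hF _ Finset.sdiff_subset
    have h1 := ih hG' ((Finset.subset_insert v G).trans hsub)
    have hlt := ker_faceMap_lt (K := K) L hG hG' (by
      rw [Finset.ssubset_iff_of_subset (Finset.sdiff_subset_sdiff subset_rfl
        (Finset.subset_insert v G))]
      exact ⟨v, Finset.mem_sdiff.2 ⟨hsub (Finset.mem_insert_self v G), hv⟩, by simp⟩)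
    have := RingHom.ker_isPrime (L.faceMap K hG)
    have := RingHom.ker_isPrime (L.faceMap K hG')
    rw [Finset.card_insert_of_notMem hv, Nat.cast_add, Nat.cast_one]
    exact (add_le_add_left h1 1).trans (Ideal.height_add_one_le_of_lt_of_isPrime hlt)

variable (K) in
/-- The augmentation `K[L] → K` that kills all variables. -/
noncomputable def augmentation (L : SimplComplex V) : L.StanleyReisnerRing K →ₐ[K] K :=
  L.srLift 0 (by
    intro F hF
    obtain ⟨v, hv⟩ : F.Nonempty := by
      rw [Finset.nonempty_iff_ne_empty]
      rintro rfl
      exact hF L.empty_mem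
    exact Finset.prod_eq_zero hv rfl)

theorem augmentation_srX (L : SimplComplex V) (v : V) : L.augmentation K (L.srX K v) = 0 :=
  srLift_srX _ _ _ v

theorem augmentation_mk (L : SimplComplex V) (p : MvPolynomial V K) :
    L.augmentation K (Ideal.Quotient.mk _ p) = MvPolynomial.constantCoeff p := by
  change MvPolynomial.aeval (0 : V → K) p = _
  rw [MvPolynomial.aeval_zero]
  rfl

instance (L : SimplComplex V) : (RingHom.ker (L.augmentation K)).IsMaximal :=
  RingHom.ker_isMaximal_of_surjective _ fun a =>
    ⟨algebraMap K _ a, (L.augmentation K).commutes a⟩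

theorem card_le_height_ker_augmentation [DecidableEq V] (L : SimplComplex V) {F : Finset V}
    (hF : F ∈ L) :
    (F.card : ℕ∞) ≤ (RingHom.ker (L.augmentation K)).height := by
  have h0 : F \ F ∈ L := L.down_closed _ hF _ Finset.sdiff_subset
  refine (card_le_height_ker_faceMap (K := K) L hF F h0 subset_rfl).trans (Ideal.height_mono ?_)
  have hcomp : (MvPolynomial.aeval (R := K) (0 : V → K)).comp (L.faceMap K h0) =
      L.augmentation K := by
    refine sr_algHom_ext fun v => ?_
    rw [AlgHom.comp_apply, faceMap_srX, augmentation_srX, Finset.sdiff_self,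
      if_neg (Finset.notMem_empty v), map_zero]
  intro p hp
  rw [RingHom.mem_ker] at hp ⊢
  rw [← hcomp, AlgHom.comp_apply, hp, map_zero]

theorem ker_augmentation_le (L : SimplComplex V) :
    RingHom.ker (L.augmentation K) ≤ Ideal.span (Set.range (L.srX K)) := by
  have key : ∀ p : MvPolynomial V K, Ideal.Quotient.mk (L.stanleyReisnerIdeal K)
      (p - MvPolynomial.C (MvPolynomial.constantCoeff p)) ∈ Ideal.span (Set.range (L.srX K)) := by
    intro p
    induction p using MvPolynomial.induction_on with
    | C a => simp
    | add p q hp hq =>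
      rw [map_add, map_add, add_sub_add_comm, map_add]
      exact add_mem hp hq
    | mul_X p v hp =>
      rw [map_mul, MvPolynomial.constantCoeff_X, mul_zero, map_zero, sub_zero, map_mul]
      exact Ideal.mul_mem_left _ _ (Ideal.subset_span ⟨v, rfl⟩)
  intro r hr
  obtain ⟨p, rfl⟩ := Ideal.Quotient.mk_surjective r
  rw [RingHom.mem_ker, augmentation_mk] at hr
  have := key p
  rwa [hr, map_zero, sub_zero] at this

end Dimension

end SimplComplex

/-! ### Localization and the Cohen–Macaulay test -/

section Koszul

variable {V : Type*} [LinearOrder V]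

theorem exists_koszulD_eq_smul_of_localization [Fintype V] {S B : Type*} [CommRing B] [CommRing S]
    [Algebra B S] (T : Submonoid B) [IsLocalization T S] {z : V → B} {c : Finset V → B}
    {b : Finset V → S} (hb : koszulD (fun v => algebraMap B S (z v)) b =
      fun F => algebraMap B S (c F)) :
    ∃ u ∈ T, ∃ b' : Finset V → B, koszulD z b' = u • c := by
  obtain ⟨s, hs⟩ := IsLocalization.exist_integer_multiples_of_finite T b
  choose b' hb' using hs
  have hkill : ∀ F, ∃ t : T, (t : B) * (koszulD z b' F - s * c F) = 0 := by
    intro F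
    refine (IsLocalization.map_eq_zero_iff T S _).1 ?_
    rw [map_sub, map_mul, sub_eq_zero]
    refine (congrFun (koszulD_algebraMap z b') F).symm.trans ?_
    have : (fun F => algebraMap B S (b' F)) = algebraMap B S (s : B) • b := by
      ext F; exact (hb' F).trans (Algebra.smul_def _ _)
    rw [this, koszulD_smul, hb]
    rfl
  choose t ht using hkill
  refine ⟨(∏ G, t G : T) * s, mul_mem (∏ G, t G : T).2 s.2, ((∏ G, t G : T) : B) • b', ?_⟩
  rw [koszulD_smul]
  ext F
  obtain ⟨q, hq⟩ : t F ∣ ∏ G, t G := Finset.dvd_prod_of_mem _ (Finset.mem_univ F)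
  rw [Pi.smul_apply, Pi.smul_apply, smul_eq_mul, smul_eq_mul, mul_assoc, ← sub_eq_zero, ← mul_sub,
    hq, Submonoid.coe_mul, mul_right_comm, ht, zero_mul]

/-- By the Nullstellensatz `R/m` is finite over `K`. The minimal polynomial of a nonzero residue has
nonzero constant term; a zero residue gives `X`. -/
theorem exists_polynomial_mem_maximal (K : Type*) {R : Type*} [Field K] [CommRing R] [Algebra K R]
    [Algebra.FiniteType K R] (m : Ideal R) [m.IsMaximal] (x : R) :
    ∃ f : Polynomial K, (f = Polynomial.X ∨ (f.Monic ∧ f.coeff 0 ≠ 0)) ∧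
      Polynomial.aeval x f ∈ m := by
  let : Field (R ⧸ m) := Ideal.Quotient.field m
  have : Module.Finite K (R ⧸ m) := finite_of_finite_type_of_isJacobsonRing K (R ⧸ m)
  have hxint : IsIntegral K (Ideal.Quotient.mk m x) := Algebra.IsIntegral.isIntegral _
  by_cases hx : Ideal.Quotient.mk m x = 0
  · exact ⟨Polynomial.X, Or.inl rfl, by
      rw [Polynomial.aeval_X]; exact Ideal.Quotient.eq_zero_iff_mem.1 hx⟩
  · refine ⟨minpoly K (Ideal.Quotient.mk m x), Or.inr ⟨minpoly.monic hxint,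
      minpoly.coeff_zero_ne_zero hxint hx⟩, ?_⟩
    rw [← Ideal.Quotient.eq_zero_iff_mem, ← Ideal.Quotient.mkₐ_eq_mk K,
      ← Polynomial.aeval_algHom_apply]
    exact minpoly.aeval K _

theorem isCohenMacaulayLocal_of_koszulDepthGE {A : Type*} [CommRing A] [IsLocalRing A]
    [IsNoetherianRing A] {z : V → A} (hz : ∀ v, z v ∈ IsLocalRing.maximalIdeal A) {e : ℕ}
    (h : KoszulDepthGE A z e) (hdim : ringKrullDim A ≤ e) : IsCohenMacaulayLocal A := by
  obtain ⟨rs, hmem, hreg, hlen⟩ := h.exists_isWeaklyRegular hz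
  have hreg' := (IsLocalRing.isRegular_iff_isWeaklyRegular_of_subset_maximalIdeal hmem).2 hreg
  refine ⟨inferInstance, rs, hmem, hreg', le_antisymm ?_ (by rwa [hlen])⟩
  rw [← ringKrullDim_add_length_eq_ringKrullDim_of_isRegular rs hreg']
  have : Nontrivial (A ⧸ Ideal.ofList rs) := by
    rw [Ideal.Quotient.nontrivial_iff]
    intro htop
    have hle : Ideal.ofList rs ≤ IsLocalRing.maximalIdeal A := Ideal.span_le.2 hmem
    rw [htop, top_le_iff] at hle
    exact (IsLocalRing.maximalIdeal.isMaximal A).ne_top hle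
  exact le_add_of_nonneg_left ringKrullDim_nonneg_of_nontrivial

end Koszul

/-! ### Reisner's criterion and the theorem -/

namespace SimplComplex

section Pure

variable {V : Type*}

theorem card_le_of_dim {L : SimplComplex V} {d : ℕ} (hd : L.dim = (d : ℤ) - 1) {F : Finset V}
    (hF : F ∈ L) : F.card ≤ d := by
  have h1 : F.card ≤ L.faces.sup Finset.card := Finset.le_sup (f := Finset.card) hF
  rw [dim] at hd
  omega

theorem exists_isFacet_superset [DecidableEq V] {L : SimplComplex V} {σ : Finset V} (hσ : σ ∈ L) :
    ∃ F, L.IsFacet F ∧ σ ⊆ F := by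
  obtain ⟨F, hF, hmax⟩ := Finset.exists_max_image (L.faces.filter (σ ⊆ ·)) Finset.card
    ⟨σ, Finset.mem_filter.2 ⟨hσ, subset_rfl⟩⟩
  rw [Finset.mem_filter] at hF
  refine ⟨F, ⟨hF.1, fun τ hτ hsub => ?_⟩, hF.2⟩
  exact (Finset.eq_of_subset_of_card_le hsub
    (hmax τ (Finset.mem_filter.2 ⟨hτ, hF.2.trans hsub⟩))).symm

theorem IsPure.card_facet [DecidableEq V] {L : SimplComplex V} (hL : L.IsPure) {d : ℕ}
    (hd : L.dim = (d : ℤ) - 1) {F : Finset V} (hF : L.IsFacet F) : F.card = d := by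
  obtain ⟨G, hG, hcard⟩ := Finset.exists_mem_eq_sup L.faces ⟨∅, L.empty_mem⟩ Finset.card
  obtain ⟨G', hG', hsub⟩ := exists_isFacet_superset (L := L) hG
  have h1 := Finset.card_le_card hsub
  have h2 := card_le_of_dim hd hG'.1
  have h3 := hL F G' hF hG'
  rw [dim] at hd
  omega

end Pure

variable {V : Type*} [LinearOrder V] [Fintype V] {K : Type*} [Field K]

/-- The sufficiency part of Reisner's criterion. -/
theorem LinksAcyclic.isCM {L : SimplComplex V} {e : ℕ} (h : L.LinksAcyclic K e)
    (hL : ∀ F ∈ L, F.card ≤ e) : L.IsCM K := by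
  refine ⟨inferInstance, fun m _ => ?_⟩
  choose f hf hfm using fun v => exists_polynomial_mem_maximal K m (L.srX K v)
  have hdepth := (h.koszulDepthGE_aeval f hf).localization (S := Localization.AtPrime m)
    m.primeCompl
  have : IsNoetherianRing (Localization.AtPrime m) :=
    IsLocalization.isNoetherianRing m.primeCompl _ inferInstance
  refine isCohenMacaulayLocal_of_koszulDepthGE (fun v => ?_) hdepth ?_
  · rw [← Localization.AtPrime.map_eq_maximalIdeal]
    exact Ideal.mem_map_of_mem _ (hfm v)
  · rw [IsLocalization.AtPrime.ringKrullDim_eq_height m]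
    exact Ideal.height_le_ringKrullDim_of_isPrime.trans (ringKrullDim_stanleyReisnerRing_le hL)

/-- Sending `γ` to `F ↦ γ(F) x^F` embeds simplicial cochains in the Koszul complex; nonfaces impose
nothing, since their monomials vanish. -/
theorem cohAcyclic_of_koszulDepthGE {L : SimplComplex V} {e : ℕ}
    (h : KoszulDepthGE (Localization.AtPrime (RingHom.ker (L.augmentation K)))
      (fun v => algebraMap (L.StanleyReisnerRing K)
        (Localization.AtPrime (RingHom.ker (L.augmentation K))) (L.srX K v)) e) :
    CohAcyclic K {G | G ∈ L} e := by
  intro γ hγ hd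
  let c : Finset V → L.StanleyReisnerRing K := fun F => γ F • ∏ v ∈ F, L.srX K v
  have hdc : koszulD (L.srX K) c = 0 := by
    ext F
    have h1 : koszulD (L.srX K) c F = koszulD (1 : V → K) γ F • ∏ v ∈ F, L.srX K v := by
      rw [koszulD_apply, koszulD_apply, Finset.sum_smul]
      refine Finset.sum_congr rfl fun v hv => ?_
      rw [← Finset.mul_prod_erase F (L.srX K) hv, Pi.one_apply, one_smul, smul_assoc,
        smul_eq_mul, mul_smul_comm]
    rw [h1, Pi.zero_apply]
    by_cases hF : F ∈ L
    · rw [hd F hF, zero_smul]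
    · rw [prod_srX_eq_zero hF, smul_zero]
  obtain ⟨b, hb⟩ := h (fun F => algebraMap _ _ (c F))
    (fun F hF => by simp only [c]; rw [hγ F hF, zero_smul, map_zero])
    (by rw [koszulD_algebraMap, hdc]; ext F; exact map_zero _)
  obtain ⟨u, hu, b', hb'⟩ := exists_koszulD_eq_smul_of_localization
    (RingHom.ker (L.augmentation K)).primeCompl hb
  obtain ⟨u, rfl⟩ := Ideal.Quotient.mk_surjective u
  choose q hq using fun F => Ideal.Quotient.mk_surjective (b' F)
  obtain rfl : (fun F => Ideal.Quotient.mk _ (q F)) = b' := funext hq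
  have hu0 : MvPolynomial.constantCoeff u ≠ 0 := fun h0 => hu (by
    rw [SetLike.mem_coe, RingHom.mem_ker, augmentation_mk, h0])
  rw [koszulD_mk] at hb'
  -- Compare coefficients of `x^F` in `d q = u c`: the denominator `u` contributes only its constant
  -- term, nonzero since `u` lies outside the augmentation ideal.
  refine ⟨fun G => (MvPolynomial.constantCoeff u)⁻¹ * (q G).coeff (sqfreeExp G), fun F hF => ?_⟩
  have h1 : koszulD (MvPolynomial.X : V → MvPolynomial V K) q F -
      u * MvPolynomial.monomial (sqfreeExp F) (γ F) ∈
      L.stanleyReisnerIdeal K := by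
    have hcF : c F = Ideal.Quotient.mk _ (MvPolynomial.monomial (sqfreeExp F) (γ F)) := by
      simp only [c]
      rw [← map_prod, prod_X_eq_monomial]
      change Ideal.Quotient.mk _ (γ F • MvPolynomial.monomial (sqfreeExp F) (1 : K)) = _
      rw [MvPolynomial.smul_monomial, smul_eq_mul, mul_one]
    rw [← Ideal.Quotient.eq, congrFun hb' F, Pi.smul_apply, hcF, smul_eq_mul, map_mul]
  have h2 := mem_stanleyReisnerIdeal.1 h1 (sqfreeExp F) (by rwa [support_sqfreeExp])
  rw [MvPolynomial.coeff_sub, MvPolynomial.coeff_mul_monomial', if_pos le_rfl, tsub_self,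
    sub_eq_zero, koszulD_apply, MvPolynomial.coeff_sum] at h2
  have h3 : γ F = (MvPolynomial.constantCoeff u)⁻¹ * (MvPolynomial.coeff 0 u * γ F) := by
    rw [← MvPolynomial.constantCoeff_eq, inv_mul_cancel_left₀ hu0]
  rw [h3, ← h2, koszulD_apply, Finset.mul_sum]
  refine Finset.sum_congr rfl fun v hv => ?_
  have h4 : sqfreeExp F - Finsupp.single v 1 = sqfreeExp (F.erase v) := by
    rw [sqfreeExp, ← Finset.add_sum_erase F _ hv, add_tsub_cancel_left]
    rfl
  rw [MvPolynomial.coeff_smul, smul_eq_mul (MvPolynomial.X v), MvPolynomial.coeff_X_mul',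
    support_sqfreeExp, if_pos hv, h4, Pi.one_apply, one_smul, mul_smul_comm]

/-- The necessity part of Reisner's criterion, for the complex itself. -/
theorem IsCM.subsingleton_reducedHomology {L : SimplComplex V} (h : L.IsCM K) {F : Finset V}
    (hF : F ∈ L) {i : ℤ} (hi : i < (F.card : ℤ) - 1) : Subsingleton (L.ReducedHomology K i) := by
  obtain ⟨-, rs, hmem, hreg, hlen⟩ := h.2 (RingHom.ker (L.augmentation K))
  refine homology_of_cohAcyclic (cohAcyclic_of_koszulDepthGE ?_) hi
  refine KoszulDepthGE.mono (hreg.toIsWeaklyRegular.koszulDepthGE fun r hr => ?_)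
    (e := rs.length) ?_
  · have := hmem r hr
    rw [← Localization.AtPrime.map_eq_maximalIdeal] at this
    have h2 := Ideal.map_mono (f := algebraMap (L.StanleyReisnerRing K)
      (Localization.AtPrime (RingHom.ker (L.augmentation K)))) (ker_augmentation_le (K := K) L) this
    rw [Ideal.map_span, ← Set.range_comp] at h2
    exact h2
  · rw [IsLocalization.AtPrime.ringKrullDim_eq_height (RingHom.ker (L.augmentation K))] at hlen
    have h1 := card_le_height_ker_augmentation (K := K) L hF
    have h2 : ((rs.length : ℕ∞) : WithBot ℕ∞) = (RingHom.ker (L.augmentation K)).height := hlen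
    rw [WithBot.coe_inj] at h2
    rw [← h2] at h1
    exact_mod_cast h1

end SimplComplex

theorem mainTheorem3 {V : Type*} [Fintype V] [LinearOrder V] (K : Type*) [Field K]
    (Δ : SimplComplex V) (d : ℕ) (hd : Δ.dim = (d : ℤ) - 1) (t : ℤ) :
    Δ.IsCMt K t ↔
      Δ.IsPure ∧ ∀ (σ : Finset V) (hσ : σ ∈ Δ), t ≤ (σ.card : ℤ) →
        ∀ i : ℤ, i < (d : ℤ) - σ.card - 1 →
          Subsingleton ((Δ.link σ hσ).ReducedHomology K i) := by
  refine and_congr_right fun hpure => ⟨fun h σ hσ ht i hi => ?_, fun h σ hσ ht => ?_⟩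
  · obtain ⟨F, hF, hsub⟩ := SimplComplex.exists_isFacet_superset hσ
    have hFσ : F \ σ ∈ Δ.link σ hσ := by
      rw [SimplComplex.mem_link, Finset.sdiff_union_of_subset hsub]
      exact ⟨hF.1, Finset.sdiff_disjoint⟩
    refine (h σ hσ ht).subsingleton_reducedHomology hFσ ?_
    have h1 := Finset.card_sdiff_add_card_eq_card hsub
    have h2 := hpure.card_facet hd hF
    omega
  -- The link of `τ` in the link of `σ` is the link of `τ ∪ σ`, which again has at least `t`
  -- vertices, so the hypothesis covers every link that Reisner's criterion tests.
  · refine SimplComplex.LinksAcyclic.isCM (e := d - σ.card) (fun τ => ?_) fun F hF => ?_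
    · by_cases hτ : τ ∈ Δ.link σ hσ
      · have hτ' := (SimplComplex.mem_link hσ).1 hτ
        have hcard := Finset.card_union_of_disjoint hτ'.2
        have hle := SimplComplex.card_le_of_dim hd hτ'.1
        have := SimplComplex.cohAcyclic_of_homology (K := K) (L := Δ.link (τ ∪ σ) hτ'.1)
          (e := d - σ.card - τ.card) fun i hi => h _ hτ'.1 (by omega) i (by omega)
        convert this using 1
        ext G
        simp only [Set.mem_ofPred_eq, SimplComplex.mem_link, Finset.disjoint_union_left,
          Finset.disjoint_union_right, Finset.union_assoc]
        tauto
      · refine cohAcyclic_of_isEmpty (fun G hG => hτ ?_) _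
        exact (Δ.link σ hσ).down_closed _ hG.2 _ Finset.subset_union_right
    · rw [SimplComplex.mem_link] at hF
      have h1 := SimplComplex.card_le_of_dim hd hF.1
      rw [Finset.card_union_of_disjoint hF.2] at h1
      omega
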